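/- Let $n\ge 0$, equip $\mathbb Z^n\times\mathbb T^n$ (where $\mathbb T^n=\mathbb R^n/\mathbb Z^n$) with the product of counting measure and normalized Haar measure $dw$, and put $M_wT_mf(k)=e^{2\pi i w\cdot k}f(k-m)$ for $k,m\in\mathbb Z^n$, $w\in\mathbb T^n$. For a window $g_0$ and $f$ (either $g_0\in\mathcal S(\mathbb Z^n)$, $f\in\mathcal S'(\mathbb Z^n)$, or $g_0,f\in\ell^2(\mathbb Z^n)$) let $V_{g_0}f(m,w)=\langle f,M_wT_mg_0\rangle$ be the short-time Fourier transform. A Young function is a convex $\Phi:[0,\infty]\to[0,\infty]$ with $\Phi(0)=0$ and $\lim_{t\to\infty}\Phi(t)=\Phi(\infty)=\infty$; on a measure space $(X,\mu)$, $\|F\|_{L^\Phi}=\inf\{b>0:\int_X\Phi(|F|/b)\,d\mu\le1\}$. Fix non-zero windows $g_0\in\mathcal S(\mathbb Z^n)$ and $h_0\in\mathcal S(\mathbb Z^n\times\mathbb T^n)$. The Orlicz modulation space $M^\Phi(\mathbb Z^n)$ is the set of $f\in\mathcal S'(\mathbb Z^n)$ with $\|f\|_{M^\Phi}:=\|V_{g_0}f\|_{L^\Phi(\mathbb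 Z^n\times\mathbb T^n)}<\infty$. A function $F$ on $\mathbb Z^n\times\mathbb T^n$ that defines a tempered distribution is in $M^1(\mathbb Z^n\times\mathbb T^n)$ if $\|F\|_{M^1}:=\|V_{h_0}F\|_{L^1((\mathbb Z^n\times\mathbb T^n)\times(\mathbb T^n\times\mathbb Z^n))}<\infty$, where $$V_{h_0}F(m,\omega,\xi,k)=\sum_{j\in\mathbb Z^n}\int_{\mathbb T^n}e^{-2\pi i j\cdot\xi}e^{-2\pi i k\cdot\eta}F(j,\eta)\overline{h_0(j-m,\eta-\omega)}\,d\eta .$$ $S_1$ is the space of compact operators $A$ on $\ell^2(\mathbb Z^n)$ for which $\|A\|_{S_1}$, the sum of the singular values of $A$ (the positive eigenvalues of $|A|=\sqrt{A^*A}$, with multiplicity), is finite. **Theorem.** There is a constant $C>0$ that depends only on $n$ and on the windows $g_0,h_0$, with $C=1$ if the windows are normalized so that $\|g_0\|_{\ell^2}\ge3$ and $\max|h_0|\ge1$, such that the following holds. Let $\Phi$ be a Young function with $$\Phi(x)=-x^2\log x\quad(0\le x\le e^{-3/2}),\qquad \Phi(0)=0,$$ let $\varsigma\in M^1(\mathbb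 Z^n\times\mathbb T^n)$ be a non-negative real-valued function, and let $g\in M^\Phi(\mathbb Z^n)$. Then $g\in\ell^2(\mathbb Z^n)$; the localization operator $$\mathfrak L^{g,g}_\varsigma f(k)=\sum_{m\in\mathbb Z^n}\int_{\mathbb T^n}\varsigma(m,w)\,V_gf(m,w)\,M_wT_mg(k)\,dw,\qquad f\in\ell^2(\mathbb Z^n),\ k\in\mathbb Z^n,$$ is given by absolutely convergent integrals and is a bounded operator on $\ell^2(\mathbb Z^n)$ that belongs to $S_1$; the function $\tilde\varsigma(m,w)=\langle\mathfrak L^{g,g}_\varsigma(M_wT_mg),M_wT_mg\rangle_{\ell^2(\mathbb Z^n)}$ is in $L^1(\mathbb Z^n\times\mathbb T^n)$; and $$\frac{1}{C\,\|g\|_{M^\Phi}^2}\,\|\tilde\varsigma\|_{L^1(\mathbb Z^n\times\mathbb T^n)}\le\|\mathfrak L^{g,g}_\varsigma\|_{S_1}\le C\,\|g\|_{M^\Phi}^2\,\|\varsigma\|_{M^1(\mathbb Z^n\times\mathbb T^n)},$$ where the left-hand side is read as $0$ if $g=0$ (in which case $\tilde\varsigma=0$). -/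

import Mathlib

open MeasureTheory Filter Topology
open scoped ENNReal NNReal ComplexConjugate InnerProductSpace ContDiff

noncomputable section

namespace DiscreteTF

/-! ### The phase space `ℤⁿ × 𝕋ⁿ` and its measures -/

/-- The lattice `ℤⁿ`. -/
abbrev Lattice (n : ℕ) : Type := Fin n → ℤ

/-- The torus `𝕋ⁿ = ℝⁿ / ℤⁿ`. The character `w ↦ e^{2πi k·w}` is `UnitAddTorus.mFourier k`. -/
abbrev Torus (n : ℕ) : Type := UnitAddTorus (Fin n)

/-- The phase space `ℤⁿ × 𝕋ⁿ`. -/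
abbrev Phase (n : ℕ) : Type := Lattice n × Torus n

/-- Haar measure `dw` on `𝕋ⁿ` of total mass one. -/
def torusMeasure (n : ℕ) : Measure (Torus n) :=
  Measure.pi fun _ => (AddCircle.haarAddCircle : Measure (AddCircle (1 : ℝ)))

/-- The measure `∑_m ∫ dw` on `ℤⁿ × 𝕋ⁿ`. -/
def phaseMeasure (n : ℕ) : Measure (Phase n) :=
  (Measure.count : Measure (Lattice n)).prod (torusMeasure n)

/-- The measure `∫ dξ ∑_k` on the dual group `𝕋ⁿ × ℤⁿ` of `ℤⁿ × 𝕋ⁿ`. -/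
def dualMeasure (n : ℕ) : Measure (Torus n × Lattice n) :=
  (torusMeasure n).prod (Measure.count : Measure (Lattice n))

/-! ### Translation and modulation on `ℤⁿ` -/

/-- `M_w T_m f (k) = e^{2πi w·k} f (k - m)`. -/
def shiftFun {n : ℕ} (m : Lattice n) (w : Torus n) (f : Lattice n → ℂ) : Lattice n → ℂ :=
  fun k => UnitAddTorus.mFourier k w * f (k - m)

theorem norm_mFourier_apply {n : ℕ} (k : Lattice n) (w : Torus n) :
    ‖UnitAddTorus.mFourier k w‖ = 1 := by
  simp only [UnitAddTorus.mFourier, ContinuousMap.coe_mk, fourier_apply, norm_prod,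
    Circle.norm_coe, Finset.prod_const_one]

theorem norm_shiftFun {n : ℕ} (m : Lattice n) (w : Torus n) (f : Lattice n → ℂ) (k : Lattice n) :
    ‖shiftFun m w f k‖ = ‖f (k - m)‖ := by
  simp [shiftFun, norm_mFourier_apply]

/-- The Hilbert space `ℓ²(ℤⁿ)`. -/
abbrev L2Z (n : ℕ) : Type := lp (fun _ : Lattice n => ℂ) 2

theorem memℓp_shiftFun {n : ℕ} (m : Lattice n) (w : Torus n) (f : L2Z n) :
    Memℓp (shiftFun m w f) 2 := by
  have h := (lp.memℓp f).summable (by norm_num)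
  refine memℓp_gen ?_
  have h' := (Equiv.subRight m).summable_iff.mpr h
  refine h'.congr fun k => ?_
  simp [norm_shiftFun]

/-- `M_w T_m` on `ℓ²(ℤⁿ)`. -/
def shift {n : ℕ} (m : Lattice n) (w : Torus n) (f : L2Z n) : L2Z n :=
  ⟨shiftFun m w f, memℓp_shiftFun m w f⟩

/-- The short-time Fourier transform `V_g f (m, w) = ⟨f, M_w T_m g⟩` of `f ∈ ℓ²(ℤⁿ)` with window
`g ∈ ℓ²(ℤⁿ)` (Mathlib's inner product is conjugate-linear in the first variable). -/
def stft {n : ℕ} (g f : L2Z n) (z : Phase n) : ℂ := ⟪shift z.1 z.2 g, f⟫_ℂ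

/-! ### Schwartz functions and tempered distributions on `ℤⁿ` -/

/-- The Schwartz space `𝓢(ℤⁿ)` of rapidly decreasing functions. -/
def schwartzZ (n : ℕ) : Submodule ℂ (Lattice n → ℂ) where
  carrier := {φ | ∀ N : ℕ, ∃ C : ℝ, ∀ k, (1 + ‖k‖) ^ N * ‖φ k‖ ≤ C}
  zero_mem' := fun _ => ⟨0, fun _ => by simp⟩
  add_mem' := by
    intro a b ha hb N
    obtain ⟨A, hA⟩ := ha N
    obtain ⟨B, hB⟩ := hb N
    refine ⟨A + B, fun k => ?_⟩
    have h1 : (0 : ℝ) ≤ (1 + ‖k‖) ^ N := by positivity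
    calc (1 + ‖k‖) ^ N * ‖(a + b) k‖ ≤ (1 + ‖k‖) ^ N * (‖a k‖ + ‖b k‖) :=
          mul_le_mul_of_nonneg_left (norm_add_le _ _) h1
      _ ≤ A + B := by rw [mul_add]; exact add_le_add (hA k) (hB k)
  smul_mem' := by
    intro c a ha N
    obtain ⟨A, hA⟩ := ha N
    refine ⟨‖c‖ * A, fun k => ?_⟩
    have h1 := mul_le_mul_of_nonneg_left (hA k) (norm_nonneg c)
    calc (1 + ‖k‖) ^ N * ‖(c • a) k‖ = ‖c‖ * ((1 + ‖k‖) ^ N * ‖a k‖) := by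
          simp only [Pi.smul_apply, norm_smul]; ring
      _ ≤ ‖c‖ * A := h1

/-- The unit sequence at `k`, as a Schwartz function. -/
def deltaZ {n : ℕ} (k : Lattice n) : schwartzZ n :=
  ⟨Pi.single k 1, fun N => ⟨(1 + ‖k‖) ^ N, fun j => by
    by_cases hj : j = k
    · subst hj; simp
    · simp only [Pi.single_eq_of_ne hj, norm_zero, mul_zero]; positivity⟩⟩

/-- The Schwartz function `k ↦ conj (M_w T_m g (k))` for `g ∈ 𝓢(ℤⁿ)`. -/
def conjShift {n : ℕ} (m : Lattice n) (w : Torus n) (g : schwartzZ n) : schwartzZ n :=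
  ⟨fun k => conj (shiftFun m w (g : Lattice n → ℂ) k), fun N => by
    obtain ⟨A, hA⟩ := g.2 N
    refine ⟨(1 + ‖m‖) ^ N * A, fun k => ?_⟩
    have h1 : 1 + ‖k‖ ≤ (1 + ‖m‖) * (1 + ‖k - m‖) := by
      have h2 : ‖k‖ ≤ ‖k - m‖ + ‖m‖ := by simpa using norm_add_le (k - m) m
      nlinarith [norm_nonneg m, norm_nonneg (k - m),
        mul_nonneg (norm_nonneg m) (norm_nonneg (k - m))]
    have h3 : (1 + ‖k‖) ^ N ≤ (1 + ‖m‖) ^ N * (1 + ‖k - m‖) ^ N := by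
      rw [← mul_pow]; exact pow_le_pow_left₀ (by positivity) h1 N
    rw [RCLike.norm_conj, norm_shiftFun]
    calc (1 + ‖k‖) ^ N * ‖(g : Lattice n → ℂ) (k - m)‖
        ≤ (1 + ‖m‖) ^ N * (1 + ‖k - m‖) ^ N * ‖(g : Lattice n → ℂ) (k - m)‖ :=
          mul_le_mul_of_nonneg_right h3 (norm_nonneg _)
      _ = (1 + ‖m‖) ^ N * ((1 + ‖k - m‖) ^ N * ‖(g : Lattice n → ℂ) (k - m)‖) := by ring
      _ ≤ (1 + ‖m‖) ^ N * A := mul_le_mul_of_nonneg_left (hA _) (by positivity)⟩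

/-- Tempered distributions on `ℤⁿ`: linear functionals on `𝓢(ℤⁿ)` that are continuous for the
seminorms `p_N φ = sup_k (1 + |k|)^N |φ k|`. These seminorms increase with `N`, so continuity means
being bounded by a multiple of one of them. -/
structure TemperedZ (n : ℕ) where
  toFun : schwartzZ n →ₗ[ℂ] ℂ
  continuous' : ∃ (C : ℝ) (N : ℕ), ∀ (φ : schwartzZ n) (B : ℝ),
    (∀ k, (1 + ‖k‖) ^ N * ‖(φ : Lattice n → ℂ) k‖ ≤ B) → ‖toFun φ‖ ≤ C * B

/-- The value at `k` of a tempered distribution on the discrete group `ℤⁿ`. -/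
def TemperedZ.coeff {n : ℕ} (f : TemperedZ n) (k : Lattice n) : ℂ := f.toFun (deltaZ k)

/-- The short-time Fourier transform `V_{g₀} f (m, w) = ⟨f, M_w T_m g₀⟩` of `f ∈ 𝓢'(ℤⁿ)` with window
`g₀ ∈ 𝓢(ℤⁿ)`. -/
def TemperedZ.stft {n : ℕ} (g₀ : schwartzZ n) (f : TemperedZ n) (z : Phase n) : ℂ :=
  f.toFun (conjShift z.1 z.2 g₀)

/-! ### Young functions, Orlicz norms, Orlicz modulation spaces -/

/-- Young functions `Φ : [0, ∞] → [0, ∞]`. -/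
structure IsYoungFunction (Φ : ℝ≥0∞ → ℝ≥0∞) : Prop where
  convex : ∀ x₁ x₂ y₁ y₂ : ℝ≥0, x₁ + x₂ = 1 →
    Φ ((x₁ * y₁ + x₂ * y₂ : ℝ≥0) : ℝ≥0∞) ≤ x₁ * Φ y₁ + x₂ * Φ y₂
  map_zero : Φ 0 = 0
  tendsto_top : Tendsto (fun t : ℝ≥0 => Φ t) atTop (𝓝 ⊤)
  map_top : Φ ⊤ = ⊤

/-- The Luxemburg norm `inf {b > 0 : ∫ Φ(|F| / b) ≤ 1}`, with value `∞` if there is no such `b`. -/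
def orliczNorm {X : Type*} [MeasurableSpace X] (Φ : ℝ≥0∞ → ℝ≥0∞) (μ : Measure X) (F : X → ℂ) :
    ℝ≥0∞ :=
  ⨅ (b : ℝ≥0) (_ : 0 < b) (_ : ∫⁻ x, Φ (‖F x‖ₑ / b) ∂μ ≤ 1), (b : ℝ≥0∞)

/-- The norm of `M^Φ(ℤⁿ)`, with respect to the window `g₀`; it is `∞` off `M^Φ(ℤⁿ)`. -/
def orliczModulationNorm {n : ℕ} (g₀ : schwartzZ n) (Φ : ℝ≥0∞ → ℝ≥0∞) (f : TemperedZ n) : ℝ≥0∞ :=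
  orliczNorm Φ (phaseMeasure n) (f.stft g₀)

/-- Membership in the Orlicz modulation space `M^Φ(ℤⁿ)`. -/
def MemOrliczModulation {n : ℕ} (g₀ : schwartzZ n) (Φ : ℝ≥0∞ → ℝ≥0∞) (f : TemperedZ n) : Prop :=
  orliczModulationNorm g₀ Φ f < ⊤

/-! ### The modulation space `M¹(ℤⁿ × 𝕋ⁿ)` -/

/-- The `ℤⁿ`-periodic function on `ℝⁿ` that corresponds to `φ(k, ·)`. -/
def liftPhase {n : ℕ} (φ : Phase n → ℂ) (k : Lattice n) (x : Fin n → ℝ) : ℂ :=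
  φ (k, fun i => (x i : AddCircle (1 : ℝ)))

/-- The Schwartz class `𝓢(ℤⁿ × 𝕋ⁿ)`: smooth in the torus variable, all derivatives in the torus
variable rapidly decreasing in the lattice variable, uniformly on the torus. -/
def IsSchwartzPhase {n : ℕ} (φ : Phase n → ℂ) : Prop :=
  (∀ k, ContDiff ℝ ∞ (liftPhase φ k)) ∧
    ∀ N l : ℕ, ∃ C : ℝ, ∀ k x, (1 + ‖k‖) ^ N * ‖iteratedFDeriv ℝ l (liftPhase φ k) x‖ ≤ C

/-- `F` is a function on `ℤⁿ × 𝕋ⁿ` that defines a tempered distribution by `φ ↦ ∑_k ∫ F φ dw`: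
the integrals converge absolutely, and are bounded by finitely many seminorms of `φ`. -/
def IsTemperedFunction {n : ℕ} (F : Phase n → ℂ) : Prop :=
  AEStronglyMeasurable F (phaseMeasure n) ∧
  (∀ φ : Phase n → ℂ, IsSchwartzPhase φ → Integrable (fun z => F z * φ z) (phaseMeasure n)) ∧
  ∃ (C : ℝ) (N : ℕ), ∀ (φ : Phase n → ℂ) (B : ℝ), IsSchwartzPhase φ →
    (∀ l ≤ N, ∀ k x, (1 + ‖k‖) ^ N * ‖iteratedFDeriv ℝ l (liftPhase φ k) x‖ ≤ B) →
    ‖∫ z, F z * φ z ∂(phaseMeasure n)‖ ≤ C * B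

/-- The short-time Fourier transform on `(ℤⁿ × 𝕋ⁿ) × (𝕋ⁿ × ℤⁿ)`,
`V_h F (m, ω, ξ, k) = ∑_j ∫ e^{-2πi j·ξ} e^{-2πi k·η} F(j, η) conj (h(j - m, η - ω)) dη`. -/
def phaseStft {n : ℕ} (h F : Phase n → ℂ) (p : Phase n × (Torus n × Lattice n)) : ℂ :=
  ∫ z : Phase n, UnitAddTorus.mFourier (-z.1) p.2.1 * UnitAddTorus.mFourier (-p.2.2) z.2 *
    F z * conj (h (z - p.1)) ∂(phaseMeasure n)

/-- The norm of `M¹(ℤⁿ × 𝕋ⁿ)` with respect to the window `h`. -/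
def modulationOneNorm {n : ℕ} (h F : Phase n → ℂ) : ℝ≥0∞ :=
  ∫⁻ p, ‖phaseStft h F p‖ₑ ∂((phaseMeasure n).prod (dualMeasure n))

/-- The function `F` belongs to `M¹(ℤⁿ × 𝕋ⁿ)`. -/
def MemModulationOne {n : ℕ} (h F : Phase n → ℂ) : Prop :=
  IsTemperedFunction F ∧ modulationOneNorm h F < ⊤

/-! ### Localization operators and the trace class -/

/-- `L` is the localization operator on `ℓ²(ℤⁿ)` with symbol `s` and windows `g₁`, `g₂`:
`L f (k) = ∑_m ∫ s(m, w) V_{g₁} f (m, w) M_w T_m g₂ (k) dw`, the integrals being absolutely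
convergent. -/
def IsLocalizationOperator {n : ℕ} (s : Phase n → ℂ) (g₁ g₂ : L2Z n) (L : L2Z n →L[ℂ] L2Z n) :
    Prop :=
  ∀ (f : L2Z n) (k : Lattice n),
    Integrable (fun z : Phase n => s z * stft g₁ f z * shift z.1 z.2 g₂ k) (phaseMeasure n) ∧
    L f k = ∫ z : Phase n, s z * stft g₁ f z * shift z.1 z.2 g₂ k ∂(phaseMeasure n)

section Schatten

variable {H : Type*} [NormedAddCommGroup H] [InnerProductSpace ℂ H] [CompleteSpace H]

/-- For a compact operator `A`, the sum of its singular values, i.e. of the positive eigenvalues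
of `|A| = √(A* A)` counted with multiplicity. -/
def schattenOneNorm (A : H →L[ℂ] H) : ℝ≥0∞ :=
  ∑' μ : {μ : ℝ // 0 < μ}, ENNReal.ofReal μ *
    (Module.finrank ℂ
      (Module.End.eigenspace ((CFC.abs A : H →L[ℂ] H) : H →ₗ[ℂ] H) ((μ : ℝ) : ℂ)) : ℝ≥0∞)

/-- The Schatten--von Neumann class `S₁`. -/
def IsTraceClass (A : H →L[ℂ] H) : Prop :=
  IsCompactOperator A ∧ schattenOneNorm A < ⊤

end Schatten

/-- `s̃(m, w) = ⟨L (M_w T_m g), M_w T_m g⟩`. -/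
def lowerSymbol {n : ℕ} (L : L2Z n →L[ℂ] L2Z n) (g : L2Z n) (z : Phase n) : ℂ :=
  ⟪shift z.1 z.2 g, L (shift z.1 z.2 g)⟫_ℂ

end DiscreteTF

end

noncomputable section

namespace DiscreteTF

open UnitAddTorus

variable {n : ℕ}

/-! ### Fourier series on the torus -/

/-! Write `π(z) = M_w T_m` for `z = (m, w)`. For an integrable symbol `s ≥ 0`, the localization
operator is the superposition `∫ s(z) ⟨π(z)γ, ·⟩ π(z)γ dz` of positive rank one operators. It is
therefore positive and compact, and its `S₁` norm is its trace: exactly `‖γ‖² ‖s‖₁`, since each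
`π(z)γ` has norm `‖γ‖`. The lower symbol is `∫ s(x) |⟨π(z)γ, π(x)γ⟩|² dx`. Integrating in `z` with
the orthogonality relation of the short-time Fourier transform gives `‖γ‖⁴ ‖s‖₁`, which is `‖γ‖²`
times the `S₁` norm. Both inequalities thus reduce to two embeddings with explicit constants.

The first is `M¹ ⊂ L¹`, with `‖F‖₁ |h(u)| ≤ ‖F‖_{M¹}` for every `u`
(`lintegral_enorm_mul_le_modulationOneNorm`). Fourier inversion bounds `|F(z) h(z - p)|` by `∫ |V_h
F(p, ζ)| dζ`; substitute `z = p + u` and integrate in `p`.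

The second is `M^Φ ⊂ ℓ²`, with `‖γ‖ ‖g₀‖ ≤ 3 ‖g‖_{M^Φ}` (`enorm_mul_enorm_le_orliczModulationNorm`).
Near zero `Φ(x) ≥ x²`, and beyond `e^{-3/2}` convexity forces `Φ(x) ≥ x/3`. So `x² ≤ max(1, 3M)
Φ(x)` for `x ≤ M`, and a bounded function with finite Orlicz norm is square integrable. The
transform of `g` is bounded because `g` has bounded coefficients; this gives `g ∈ ℓ²`.
Cauchy-Schwarz then supplies a sharper `M`, which yields the constant 3. Its square 9 cancels
against `‖g₀‖² ≥ 9`, so the normalized windows allow `C = 1`. -/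

instance : IsProbabilityMeasure (torusMeasure n) := by unfold torusMeasure; infer_instance

instance : Measure.IsAddHaarMeasure (torusMeasure n) := by unfold torusMeasure; infer_instance

instance : SigmaFinite (phaseMeasure n) := by unfold phaseMeasure; infer_instance

instance : SigmaFinite (dualMeasure n) := by unfold dualMeasure; infer_instance

instance : BorelSpace (Phase n) := by infer_instance

instance : SecondCountableTopology (Phase n) := by infer_instance

instance : BorelSpace (Torus n × Lattice n) := by infer_instance

instance : SecondCountableTopology (Torus n × Lattice n) := by infer_instance

instance : BorelSpace (Phase n × Phase n) := Prod.borelSpace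

instance : Measure.IsAddLeftInvariant (phaseMeasure n) := Measure.prod.instIsAddLeftInvariant

instance : Measure.IsOpenPosMeasure (phaseMeasure n) := Measure.prod.instIsOpenPosMeasure

theorem enorm_mFourier_apply (k : Lattice n) (w : Torus n) : ‖mFourier k w‖ₑ = 1 := by
  rw [← ofReal_norm, norm_mFourier_apply, ENNReal.ofReal_one]

theorem integrable_torus_of_continuous {f : Torus n → ℂ} (hf : Continuous f) :
    Integrable f (torusMeasure n) :=
  hf.integrable_of_hasCompactSupport (HasCompactSupport.of_compactSpace f)

theorem integral_mFourier_mul_mFourier (k l : Lattice n) :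
    ∫ w, mFourier (-k) w * mFourier l w ∂(torusMeasure n) = if k = l then 1 else 0 := by
  have h := orthonormal_iff_ite.mp (orthonormal_mFourier (d := Fin n)) k l
  rw [ContinuousMap.inner_toLp] at h
  rw [← h]
  refine integral_congr_ae (Eventually.of_forall fun w => ?_)
  simp only [mFourier_neg]
  ring

theorem continuous_tsum_mFourier {a : Lattice n → ℂ} (ha : Summable a) :
    Continuous fun w : Torus n => ∑' l, a l * mFourier l w := by
  refine continuous_tsum (fun l => by fun_prop) ha.norm fun l w => ?_
  simp [norm_mFourier_apply]

theorem hasSum_integral_mul_tsum_mFourier {a : Lattice n → ℂ} (ha : Summable a) {b : Torus n → ℂ}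
    (hb : Continuous b) :
    HasSum (fun l => a l * ∫ w, b w * mFourier l w ∂(torusMeasure n))
      (∫ w, b w * ∑' l, a l * mFourier l w ∂(torusMeasure n)) := by
  have h := hasSum_integral_of_summable_integral_norm (μ := torusMeasure n)
    (F := fun l w => a l * (b w * mFourier l w))
    (fun l => integrable_torus_of_continuous (by fun_prop)) (by
      simp only [norm_mul, norm_mFourier_apply, mul_one, integral_const_mul]
      exact ha.norm.mul_right _)
  have e : ∫ w, b w * ∑' l, a l * mFourier l w ∂(torusMeasure n)
      = ∫ w, ∑' l, a l * (b w * mFourier l w) ∂(torusMeasure n) := by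
    refine integral_congr_ae (Eventually.of_forall fun w => ?_)
    change b w * _ = _
    rw [← tsum_mul_left]
    exact tsum_congr fun l => by ring
  rw [e]
  simpa only [integral_const_mul] using h

/-- The Fourier coefficients of an absolutely convergent Fourier series. -/
theorem integral_mFourier_mul_tsum {a : Lattice n → ℂ} (ha : Summable a) (k : Lattice n) :
    ∫ w, mFourier (-k) w * ∑' l, a l * mFourier l w ∂(torusMeasure n) = a k := by
  have h := hasSum_integral_mul_tsum_mFourier ha (b := fun w => mFourier (-k) w) (by fun_prop)
  simp only [integral_mFourier_mul_mFourier] at h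
  refine h.unique ?_
  convert hasSum_ite_eq k (a k) using 2 with l
  by_cases hl : l = k
  · subst hl; simp
  · simp [hl, Ne.symm hl]

/-- Parseval's identity for an absolutely convergent Fourier series. -/
theorem lintegral_enorm_sq_tsum_mFourier {a : Lattice n → ℂ} (ha : Summable a) :
    ∫⁻ w, ‖∑' l, a l * mFourier l w‖ₑ ^ 2 ∂(torusMeasure n) = ∑' l, ‖a l‖ₑ ^ 2 := by
  set f : Torus n → ℂ := fun w => ∑' l, a l * mFourier l w with hf
  have hfc : Continuous f := continuous_tsum_mFourier ha
  have h := hasSum_integral_mul_tsum_mFourier ha (b := fun w => conj (f w)) (by fun_prop)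
  have h2 : ∀ l, ∫ w, conj (f w) * mFourier l w ∂(torusMeasure n) = conj (a l) := by
    intro l
    rw [← integral_mFourier_mul_tsum ha l, ← integral_conj]
    refine integral_congr_ae (Eventually.of_forall fun w => ?_)
    simp only [map_mul, mFourier_neg, RCLike.conj_conj, hf]
    ring
  simp only [h2] at h
  change HasSum _ (∫ w, conj (f w) * f w ∂(torusMeasure n)) at h
  simp only [Complex.mul_conj', Complex.conj_mul'] at h
  have h3 : ∫ w, ((‖f w‖ : ℂ)) ^ 2 ∂(torusMeasure n)
      = ((∫ w, ‖f w‖ ^ 2 ∂(torusMeasure n) : ℝ) : ℂ) := by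
    rw [← integral_complex_ofReal]; simp
  rw [h3] at h
  have h4 : HasSum (fun l => ‖a l‖ ^ 2) (∫ w, ‖f w‖ ^ 2 ∂(torusMeasure n)) := by
    rw [← Complex.hasSum_ofReal]; simpa using h
  have e : ∀ z : ℂ, ‖z‖ₑ ^ 2 = ENNReal.ofReal (‖z‖ ^ 2) := fun z => by
    rw [ENNReal.ofReal_pow (norm_nonneg _), ofReal_norm]
  simp only [e]
  rw [← ENNReal.ofReal_tsum_of_nonneg (fun _ => by positivity) h4.summable, h4.tsum_eq,
    ofReal_integral_eq_lintegral_ofReal]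
  · exact (hfc.norm.pow 2).integrable_of_hasCompactSupport (HasCompactSupport.of_compactSpace _)
  · exact Eventually.of_forall fun _ => by positivity

/-- An integrable function on the torus is determined by its Fourier coefficients. -/
theorem ae_eq_zero_of_integral_mFourier_eq_zero {f : Torus n → ℂ}
    (hf : Integrable f (torusMeasure n))
    (h : ∀ k, ∫ w, mFourier k w * f w ∂(torusMeasure n) = 0) : f =ᵐ[torusMeasure n] 0 := by
  have hint : ∀ φ : C(Torus n, ℂ), Integrable (fun w => φ w * f w) (torusMeasure n) := fun φ =>
    hf.bdd_mul φ.continuous.aestronglyMeasurable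
      (Eventually.of_forall fun w => φ.norm_coe_le_norm w)
  -- The functional `φ ↦ ∫ φ f` is bounded by `‖f‖₁` in the sup norm and kills the characters, whose
  -- span is dense.
  have key : ∀ φ : C(Torus n, ℂ), ∫ w, φ w * f w ∂(torusMeasure n) = 0 := by
    let T : C(Torus n, ℂ) →ₗ[ℂ] ℂ :=
      { toFun := fun φ => ∫ w, φ w * f w ∂(torusMeasure n)
        map_add' := fun φ ψ => by
          simp only [ContinuousMap.add_apply, add_mul]
          exact integral_add (hint φ) (hint ψ)
        map_smul' := fun c φ => by
          simp only [ContinuousMap.smul_apply, smul_eq_mul, mul_assoc, RingHom.id_apply]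
          exact integral_const_mul _ _ }
    let T' : C(Torus n, ℂ) →L[ℂ] ℂ := T.mkContinuous (∫ w, ‖f w‖ ∂(torusMeasure n)) fun φ => by
      rw [mul_comm, ← integral_const_mul]
      refine norm_integral_le_of_norm_le (hf.norm.const_mul _) (Eventually.of_forall fun w => ?_)
      rw [norm_mul]
      exact mul_le_mul_of_nonneg_right (φ.norm_coe_le_norm w) (norm_nonneg _)
    have hle : (Submodule.span ℂ (Set.range (mFourier (d := Fin n)))).topologicalClosure
        ≤ LinearMap.ker T'.toLinearMap := by
      refine Submodule.topologicalClosure_minimal _ ?_ T'.isClosed_ker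
      rw [Submodule.span_le]
      rintro _ ⟨k, rfl⟩
      exact h k
    rw [span_mFourier_closure_eq_top] at hle
    intro φ
    exact hle (Submodule.mem_top (x := φ))
  refine ae_eq_zero_of_forall_setIntegral_isClosed_eq_zero hf fun s hs => ?_
  have hδ : ∀ j : ℕ, (0 : ℝ) < 1 / ((j : ℝ) + 1) := fun j => by positivity
  -- Continuous thickened indicators decrease to the indicator of the closed set `s`, so `∫_s f = 0`
  -- by dominated convergence.
  have hlim := thickenedIndicator_tendsto_indicator_closure hδ
    tendsto_one_div_add_atTop_nhds_zero_nat s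
  rw [hs.closure_eq, tendsto_pi_nhds] at hlim
  have hconv : Tendsto (fun j : ℕ => ∫ w, ((thickenedIndicator (hδ j) s w : ℝ) : ℂ) * f w
      ∂(torusMeasure n)) atTop (𝓝 (∫ w, s.indicator f w ∂(torusMeasure n))) := by
    refine tendsto_integral_of_dominated_convergence (fun w => ‖f w‖) (fun j => ?_) hf.norm
      (fun j => Eventually.of_forall fun w => ?_) (Eventually.of_forall fun w => ?_)
    · refine AEStronglyMeasurable.mul (Continuous.aestronglyMeasurable ?_) hf.1
      exact Complex.continuous_ofReal.comp
        (NNReal.continuous_coe.comp (thickenedIndicator (hδ j) s).continuous)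
    · rw [norm_mul]
      refine mul_le_of_le_one_left (norm_nonneg _) ?_
      rw [Complex.norm_real, NNReal.norm_eq]
      exact_mod_cast thickenedIndicator_le_one (hδ j) s w
    · have h1 : Tendsto (fun j : ℕ => ((thickenedIndicator (hδ j) s w : ℝ) : ℂ) * f w) atTop
          (𝓝 ((((s.indicator (fun _ => (1 : ℝ≥0)) w : ℝ≥0) : ℝ) : ℂ) * f w)) :=
        ((Complex.continuous_ofReal.comp NNReal.continuous_coe).continuousAt.tendsto.comp
          (hlim w)).mul_const _
      convert h1 using 2
      by_cases hw : w ∈ s <;> simp [hw]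
  rw [← integral_indicator hs.measurableSet]
  refine tendsto_nhds_unique hconv ?_
  have hz : ∀ j : ℕ, ∫ w, ((thickenedIndicator (hδ j) s w : ℝ) : ℂ) * f w ∂(torusMeasure n) = 0 :=
    fun j => key ⟨fun w => ((thickenedIndicator (hδ j) s w : ℝ) : ℂ),
      Complex.continuous_ofReal.comp
        (NNReal.continuous_coe.comp (thickenedIndicator (hδ j) s).continuous)⟩
  simp only [hz]
  exact tendsto_const_nhds

/-- An integrable function is bounded by the sum of the moduli of its Fourier coefficients. -/
theorem ae_enorm_le_tsum_enorm_coeff {f : Torus n → ℂ} (hf : Integrable f (torusMeasure n)) :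
    ∀ᵐ w ∂(torusMeasure n),
      ‖f w‖ₑ ≤ ∑' k, ‖∫ w, mFourier (-k) w * f w ∂(torusMeasure n)‖ₑ := by
  set a : Lattice n → ℂ := fun k => ∫ w, mFourier (-k) w * f w ∂(torusMeasure n) with ha
  change ∀ᵐ w ∂(torusMeasure n), ‖f w‖ₑ ≤ ∑' k, ‖a k‖ₑ
  by_cases htop : ∑' k, ‖a k‖ₑ = ⊤
  · simp [htop]
  have hs : Summable a := by
    refine Summable.of_norm ?_
    have := ENNReal.summable_toReal htop
    simpa using this
  have hc := continuous_tsum_mFourier hs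
  have hzero : (fun w => f w - ∑' l, a l * mFourier l w) =ᵐ[torusMeasure n] 0 := by
    refine ae_eq_zero_of_integral_mFourier_eq_zero (hf.sub (integrable_torus_of_continuous hc))
      fun k => ?_
    have h1 : Integrable (fun w => mFourier k w * f w) (torusMeasure n) :=
      hf.bdd_mul (mFourier k).continuous.aestronglyMeasurable
        (Eventually.of_forall fun w => (norm_mFourier_apply k w).le)
    simp only [mul_sub]
    rw [integral_sub h1 (integrable_torus_of_continuous (by fun_prop)), sub_eq_zero]
    have h2 := integral_mFourier_mul_tsum hs (-k)
    rw [neg_neg] at h2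
    rw [h2]
    change _ = ∫ w, mFourier (-(-k)) w * f w ∂(torusMeasure n)
    rw [neg_neg]
  filter_upwards [hzero] with w hw
  rw [sub_eq_zero.mp hw]
  refine (enorm_tsum_le_tsum_enorm).trans ?_
  simp [enorm_mul, enorm_mFourier_apply, ha]

/-! ### Integrals over phase space -/

theorem lintegral_phase {f : Phase n → ℝ≥0∞} (hf : AEMeasurable f (phaseMeasure n)) :
    ∫⁻ z, f z ∂(phaseMeasure n) = ∑' k, ∫⁻ w, f (k, w) ∂(torusMeasure n) := by
  rw [phaseMeasure, lintegral_prod _ hf, lintegral_count]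

theorem integrable_fiber {E : Type*} [NormedAddCommGroup E] {F : Phase n → E}
    (hF : Integrable F (phaseMeasure n)) (k : Lattice n) :
    Integrable (fun w => F (k, w)) (torusMeasure n) := by
  have h : ∀ᵐ k ∂(Measure.count : Measure (Lattice n)),
      Integrable (fun w => F (k, w)) (torusMeasure n) := Integrable.prod_right_ae hF
  exact Measure.ae_count_iff.mp h k

theorem summable_integral_fiber {F : Phase n → ℂ} (hF : Integrable F (phaseMeasure n)) :
    Summable fun k => ∫ w, ‖F (k, w)‖ ∂(torusMeasure n) := by
  have h : Integrable (fun k => ∫ w, ‖F (k, w)‖ ∂(torusMeasure n)) Measure.count :=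
    Integrable.integral_prod_left hF.norm
  exact (integrable_count_iff.mp h).of_norm

theorem integral_phase {F : Phase n → ℂ} (hF : Integrable F (phaseMeasure n)) :
    ∫ z, F z ∂(phaseMeasure n) = ∑' k, ∫ w, F (k, w) ∂(torusMeasure n) := by
  have h : Integrable (fun k => ∫ w, F (k, w) ∂(torusMeasure n)) Measure.count :=
    Integrable.integral_prod_left hF
  rw [phaseMeasure, integral_prod _ hF, integral_countable h]
  simp

/-! ### The Fourier transform on phase space -/

/-- The Fourier transform of a function on `ℤⁿ × 𝕋ⁿ`. -/
def phaseFourier (H : Phase n → ℂ) (ζ : Torus n × Lattice n) : ℂ :=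
  ∫ z : Phase n, mFourier (-z.1) ζ.1 * mFourier (-ζ.2) z.2 * H z ∂(phaseMeasure n)

theorem continuous_mFourier_uncurry : Continuous fun q : Lattice n × Torus n => mFourier q.1 q.2 :=
  continuous_prod_of_discrete_left.mpr fun k => (mFourier k).continuous

theorem integrable_phaseFourier_integrand {H : Phase n → ℂ} (hH : Integrable H (phaseMeasure n))
    (ζ : Torus n × Lattice n) :
    Integrable (fun z : Phase n => mFourier (-z.1) ζ.1 * mFourier (-ζ.2) z.2 * H z)
      (phaseMeasure n) := by
  refine hH.bdd_mul (c := 1) (Continuous.aestronglyMeasurable ?_) (Eventually.of_forall fun z => ?_)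
  · refine Continuous.mul ?_ (by fun_prop)
    exact continuous_mFourier_uncurry.comp (Continuous.prodMk (by fun_prop) continuous_const)
  · simp [norm_mFourier_apply]

/-- Fourier inversion in the lattice variable. -/
theorem phaseFourier_eq_tsum {H : Phase n → ℂ} (hH : Integrable H (phaseMeasure n))
    (ξ : Torus n) (k : Lattice n) :
    phaseFourier H (ξ, k)
      = ∑' l, (∫ w, mFourier (-k) w * H (-l, w) ∂(torusMeasure n)) * mFourier l ξ := by
  rw [phaseFourier, integral_phase (integrable_phaseFourier_integrand hH _),
    ← (Equiv.neg (Lattice n)).tsum_eq]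
  refine tsum_congr fun l => ?_
  simp only [Equiv.neg_apply, neg_neg, mul_assoc]
  rw [integral_const_mul, mul_comm]

/-- The coefficient is itself the coefficient of index `-j` of the Fourier series `ξ ↦ phaseFourier
H (ξ, k)`, hence at most its `L¹` norm. -/
theorem enorm_coeff_le {H : Phase n → ℂ} (hH : Integrable H (phaseMeasure n)) (j k : Lattice n) :
    ‖∫ w, mFourier (-k) w * H (j, w) ∂(torusMeasure n)‖ₑ
      ≤ ∫⁻ ξ, ‖phaseFourier H (ξ, k)‖ₑ ∂(torusMeasure n) := by
  set a : Lattice n → ℂ := fun l => ∫ w, mFourier (-k) w * H (-l, w) ∂(torusMeasure n) with ha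
  have hs : Summable a := by
    have h := (Equiv.neg (Lattice n)).summable_iff.mpr (summable_integral_fiber hH)
    refine Summable.of_norm_bounded h fun l => ?_
    refine (norm_integral_le_integral_norm _).trans (le_of_eq ?_)
    simp [norm_mFourier_apply]
  have h1 := integral_mFourier_mul_tsum hs (-j)
  have h2 : a (-j) = ∫ w, mFourier (-k) w * H (j, w) ∂(torusMeasure n) := by
    simp only [ha, neg_neg]
  rw [← h2, ← h1]
  refine (enorm_integral_le_lintegral_enorm _).trans (le_of_eq ?_)
  refine lintegral_congr fun ξ => ?_
  rw [enorm_mul, enorm_mFourier_apply, one_mul, phaseFourier_eq_tsum hH]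

/-- Inversion in both variables, as a sup bound. The transform need not be integrable: the right
side may be infinite. -/
theorem ae_enorm_le_lintegral_phaseFourier {H : Phase n → ℂ} (hH : Integrable H (phaseMeasure n))
    (hm : AEMeasurable (phaseFourier H) (dualMeasure n)) (j : Lattice n) :
    ∀ᵐ w ∂(torusMeasure n), ‖H (j, w)‖ₑ ≤ ∫⁻ ζ, ‖phaseFourier H ζ‖ₑ ∂(dualMeasure n) := by
  filter_upwards [ae_enorm_le_tsum_enorm_coeff (integrable_fiber hH j)] with w hw
  refine hw.trans ?_
  rw [dualMeasure, lintegral_prod_symm _ hm.enorm, lintegral_count]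
  exact ENNReal.tsum_le_tsum fun k => enorm_coeff_le hH j k

/-! ### Schwartz functions on phase space -/

/-- The covering `ℝⁿ → 𝕋ⁿ` is an open quotient map, so continuity descends from the lift. -/
theorem IsSchwartzPhase.continuous {h : Phase n → ℂ} (hh : IsSchwartzPhase h) : Continuous h := by
  refine continuous_prod_of_discrete_left.mpr fun k => ?_
  have hq : IsOpenQuotientMap (Pi.map fun _ : Fin n => ((↑) : ℝ → AddCircle (1 : ℝ))) :=
    IsOpenQuotientMap.piMap fun _ => QuotientAddGroup.isOpenQuotientMap_mk
  exact hq.isQuotientMap.continuous_iff.mpr (hh.1 k).continuous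

theorem IsSchwartzPhase.comp_sub {h : Phase n → ℂ} (hh : IsSchwartzPhase h) (p : Phase n) :
    IsSchwartzPhase fun z => h (z - p) := by
  have hsurj : Function.Surjective (Pi.map fun _ : Fin n => ((↑) : ℝ → AddCircle (1 : ℝ))) :=
    Function.Surjective.piMap fun _ => QuotientAddGroup.mk_surjective
  obtain ⟨y, hy⟩ := hsurj p.2
  have e : ∀ k, liftPhase (fun z => h (z - p)) k = fun x => liftPhase h (k - p.1) (x - y) := by
    intro k
    funext x
    unfold liftPhase
    refine congrArg h (Prod.ext rfl ?_)
    funext i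
    change (x i : AddCircle (1 : ℝ)) - p.2 i = ((x i - y i : ℝ) : AddCircle (1 : ℝ))
    rw [← hy, AddCircle.coe_sub]
    rfl
  refine ⟨fun k => ?_, fun N l => ?_⟩
  · rw [e]
    exact (hh.1 _).comp (contDiff_id.sub contDiff_const)
  · obtain ⟨C, hC⟩ := hh.2 N l
    refine ⟨(1 + ‖p.1‖) ^ N * C, fun k x => ?_⟩
    rw [e, iteratedFDeriv_comp_sub]
    have h1 : 1 + ‖k‖ ≤ (1 + ‖p.1‖) * (1 + ‖k - p.1‖) := by
      have h2 : ‖k‖ ≤ ‖k - p.1‖ + ‖p.1‖ := by simpa using norm_add_le (k - p.1) p.1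
      nlinarith [norm_nonneg p.1, norm_nonneg (k - p.1),
        mul_nonneg (norm_nonneg p.1) (norm_nonneg (k - p.1))]
    calc (1 + ‖k‖) ^ N * ‖iteratedFDeriv ℝ l (liftPhase h (k - p.1)) (x - y)‖
        ≤ ((1 + ‖p.1‖) * (1 + ‖k - p.1‖)) ^ N *
          ‖iteratedFDeriv ℝ l (liftPhase h (k - p.1)) (x - y)‖ := by gcongr
      _ = (1 + ‖p.1‖) ^ N * ((1 + ‖k - p.1‖) ^ N *
          ‖iteratedFDeriv ℝ l (liftPhase h (k - p.1)) (x - y)‖) := by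
          rw [mul_pow, mul_assoc]
      _ ≤ _ := mul_le_mul_of_nonneg_left (hC _ _) (by positivity)

/-! ### `M¹` is contained in `L¹` -/

theorem phaseStft_eq_phaseFourier (h F : Phase n → ℂ) (p : Phase n) (ζ : Torus n × Lattice n) :
    phaseStft h F (p, ζ) = phaseFourier (fun z => F z * conj (h (z - p))) ζ := by
  simp only [phaseStft, phaseFourier, mul_assoc]

theorem continuous_mFourier_neg_uncurry :
    Continuous fun q : Lattice n × Torus n => mFourier (-q.1) q.2 :=
  continuous_prod_of_discrete_left.mpr fun k => (mFourier (-k)).continuous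

theorem measurable_mFourier_neg_uncurry :
    Measurable fun q : Lattice n × Torus n => mFourier (-q.1) q.2 :=
  continuous_mFourier_neg_uncurry.measurable

theorem measurable_mFourier_neg {α : Type*} [MeasurableSpace α] {k : α → Lattice n}
    {w : α → Torus n} (hk : Measurable k) (hw : Measurable w) :
    Measurable fun a => mFourier (-k a) (w a) := by
  have h := measurable_mFourier_neg_uncurry.comp (hk.prodMk hw)
  exact h

theorem measurable_comp_sub {h : Phase n → ℂ} (hh : Continuous h) :
    Measurable fun r : Phase n × Phase n => h (r.2 - r.1) :=
  (hh.comp (continuous_snd.sub continuous_fst)).measurable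

theorem measurable_phaseStft {h F : Phase n → ℂ} (hh : Continuous h) (hF : StronglyMeasurable F) :
    Measurable (phaseStft h F) := by
  have h1 : Measurable fun q : (Phase n × (Torus n × Lattice n)) × Phase n =>
      mFourier (-q.2.1) q.1.2.1 :=
    measurable_mFourier_neg (measurable_fst.comp measurable_snd)
      (measurable_fst.comp (measurable_snd.comp measurable_fst))
  have h2 : Measurable fun q : (Phase n × (Torus n × Lattice n)) × Phase n =>
      mFourier (-q.1.2.2) q.2.2 :=
    measurable_mFourier_neg (measurable_snd.comp (measurable_snd.comp measurable_fst))
      (measurable_snd.comp measurable_snd)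
  have h3 : Measurable fun q : (Phase n × (Torus n × Lattice n)) × Phase n =>
      h (q.2 - q.1.1) :=
    (measurable_comp_sub hh).comp ((measurable_fst.comp measurable_fst).prodMk measurable_snd)
  have h5 : Measurable fun q : (Phase n × (Torus n × Lattice n)) × Phase n => F q.2 :=
    hF.measurable.comp measurable_snd
  have h4 := ((h1.mul h2).mul h5).mul (Complex.continuous_conj.measurable.comp h3)
  exact h4.stronglyMeasurable.integral_prod_right'.measurable

/-- After the substitution `z = p + u` the hypothesis holds for almost all pairs `(p, u)`; integrate
in `p` for fixed `u` and use translation invariance. -/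
theorem ae_lintegral_mul_le {G : Type*} [AddCommGroup G] [MeasurableSpace G] [MeasurableAdd₂ G]
    [MeasurableSub₂ G] {μ : Measure G} [SigmaFinite μ] [μ.IsAddLeftInvariant]
    {f h b : G → ℝ≥0∞} (hf : Measurable f) (hh : Measurable h) (hb : Measurable b)
    (hfin : ∀ u, h u ≠ ⊤) (hle : ∀ p, ∀ᵐ z ∂μ, f z * h (z - p) ≤ b p) :
    ∀ᵐ u ∂μ, (∫⁻ z, f z ∂μ) * h u ≤ ∫⁻ p, b p ∂μ := by
  have hDm : Measurable fun q : G × G => f (q.2 + q.1) * h q.1 - b q.2 :=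
    ((hf.comp (measurable_snd.add measurable_fst)).mul (hh.comp measurable_fst)).sub
      (hb.comp measurable_snd)
  -- Truncated subtraction vanishes exactly where the inequality holds, so Tonelli exchanges the two
  -- almost-everywhere quantifiers.
  have hswap : ∫⁻ u, ∫⁻ p, (f (p + u) * h u - b p) ∂μ ∂μ = 0 := by
    rw [lintegral_lintegral_swap hDm.aemeasurable, ← lintegral_zero (μ := μ)]
    refine lintegral_congr fun p => ?_
    have h1 := lintegral_add_left_eq_self (μ := μ) (fun z => f z * h (z - p) - b p) p
    simp only [add_sub_cancel_left] at h1
    rw [h1, ← lintegral_zero (μ := μ)]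
    exact lintegral_congr_ae ((hle p).mono fun z hz => tsub_eq_zero_of_le hz)
  rw [lintegral_eq_zero_iff hDm.lintegral_prod_right'] at hswap
  filter_upwards [hswap] with u hu
  have hm : Measurable fun p => f (p + u) * h u - b p := hDm.comp measurable_prodMk_left
  rw [Pi.zero_apply, lintegral_eq_zero_iff hm] at hu
  have h2 : ∫⁻ z, f z ∂μ = ∫⁻ p, f (p + u) ∂μ := by
    simp only [add_comm _ u]
    exact (lintegral_add_left_eq_self f u).symm
  rw [h2, ← lintegral_mul_const' _ _ (hfin u)]
  exact lintegral_mono_ae (hu.mono fun p hp => tsub_eq_zero_iff_le.mp hp)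

instance : MeasurableAdd₂ (Phase n) := ⟨(continuous_fst.add continuous_snd).measurable⟩

instance : MeasurableSub₂ (Phase n) := ⟨(continuous_fst.sub continuous_snd).measurable⟩

theorem ae_enorm_mul_le_lintegral_phaseStft {h F : Phase n → ℂ} (hh : IsSchwartzPhase h)
    (hF : StronglyMeasurable F)
    (hint : ∀ φ, IsSchwartzPhase φ → Integrable (fun z => F z * φ z) (phaseMeasure n))
    (p : Phase n) :
    ∀ᵐ z ∂(phaseMeasure n), ‖F z‖ₑ * ‖h (z - p)‖ₑ
      ≤ ∫⁻ ζ, ‖phaseStft h F (p, ζ)‖ₑ ∂(dualMeasure n) := by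
  have hc := hh.continuous
  have hcp : Continuous fun z => h (z - p) := (hh.comp_sub p).continuous
  have hHm : StronglyMeasurable fun z => F z * conj (h (z - p)) :=
    hF.mul (Complex.continuous_conj.comp hcp).stronglyMeasurable
  have hH : Integrable (fun z => F z * conj (h (z - p))) (phaseMeasure n) :=
    (hint _ (hh.comp_sub p)).mono hHm.aestronglyMeasurable
      (Eventually.of_forall fun z => by simp only [norm_mul, RCLike.norm_conj, le_refl])
  have hVp : Measurable fun ζ => phaseStft h F (p, ζ) :=
    (measurable_phaseStft hc hF).comp measurable_prodMk_left
  simp only [phaseStft_eq_phaseFourier] at hVp ⊢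
  set B := ∫⁻ ζ, ‖phaseFourier (fun z => F z * conj (h (z - p))) ζ‖ₑ ∂(dualMeasure n)
  have hm : MeasurableSet {z | ‖F z‖ₑ * ‖h (z - p)‖ₑ ≤ B} :=
    measurableSet_le (hF.measurable.enorm.mul hcp.measurable.enorm) measurable_const
  refine (Measure.ae_prod_mem_iff_ae_ae_mem hm).mpr (Measure.ae_count_iff.mpr fun j => ?_)
  filter_upwards [ae_enorm_le_lintegral_phaseFourier hH hVp.aemeasurable j] with w hw
  simpa only [enorm_mul, RCLike.enorm_conj] using hw

theorem lintegral_enorm_mul_le_of_stronglyMeasurable {h F : Phase n → ℂ} (hh : IsSchwartzPhase h)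
    (hF : StronglyMeasurable F)
    (hint : ∀ φ, IsSchwartzPhase φ → Integrable (fun z => F z * φ z) (phaseMeasure n))
    (hfin : modulationOneNorm h F < ⊤) (u : Phase n) :
    (∫⁻ z, ‖F z‖ₑ ∂(phaseMeasure n)) * ‖h u‖ₑ ≤ modulationOneNorm h F := by
  have hc := hh.continuous
  have hV := measurable_phaseStft hc hF
  have hae := ae_lintegral_mul_le (μ := phaseMeasure n) hF.measurable.enorm hc.measurable.enorm
    hV.enorm.lintegral_prod_right' (fun _ => enorm_ne_top)
    (ae_enorm_mul_le_lintegral_phaseStft hh hF hint)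
  rw [← lintegral_prod _ hV.enorm.aemeasurable, ← modulationOneNorm] at hae
  set I : ℝ≥0∞ := ∫⁻ z, ‖F z‖ₑ ∂(phaseMeasure n) with hI
  by_cases hI0 : I = 0
  · simp [hI0]
  -- `I` is not yet known to be finite, and `x ↦ ⊤ * x` is discontinuous at 0. Dividing leaves a
  -- closed condition on the continuous function `‖h‖ₑ`, which passes from a dense set to every `u`.
  have hiff : ∀ u, I * ‖h u‖ₑ ≤ modulationOneNorm h F ↔ ‖h u‖ₑ ≤ modulationOneNorm h F / I := by
    intro u
    rw [ENNReal.le_div_iff_mul_le (Or.inl hI0) (Or.inr hfin.ne), mul_comm]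
  simp only [hiff] at hae ⊢
  have hclosed : IsClosed {u | ‖h u‖ₑ ≤ modulationOneNorm h F / I} :=
    isClosed_le hc.enorm continuous_const
  have hdense := Measure.dense_of_ae hae
  have huniv := hclosed.closure_eq.symm.trans hdense.closure_eq
  exact huniv.ge (Set.mem_univ u)

theorem lintegral_enorm_mul_le_modulationOneNorm {h F : Phase n → ℂ} (hh : IsSchwartzPhase h)
    (hF : MemModulationOne h F) (u : Phase n) :
    (∫⁻ z, ‖F z‖ₑ ∂(phaseMeasure n)) * ‖h u‖ₑ ≤ modulationOneNorm h F := by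
  obtain ⟨⟨hFm, hint, -⟩, hfin⟩ := hF
  have hae := hFm.ae_eq_mk
  have hst : phaseStft h F = phaseStft h (hFm.mk F) := by
    funext p
    refine integral_congr_ae ?_
    filter_upwards [hae] with z hz
    rw [hz]
  have hM : modulationOneNorm h F = modulationOneNorm h (hFm.mk F) := by
    simp only [modulationOneNorm, hst]
  have hI : ∫⁻ z, ‖F z‖ₑ ∂(phaseMeasure n) = ∫⁻ z, ‖hFm.mk F z‖ₑ ∂(phaseMeasure n) :=
    lintegral_congr_ae (hae.mono fun z hz => by simp only [hz])
  rw [hM, hI]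
  refine lintegral_enorm_mul_le_of_stronglyMeasurable hh hFm.stronglyMeasurable_mk (fun φ hφ => ?_)
    (hM ▸ hfin) u
  refine (hint φ hφ).congr (hae.mono fun z hz => ?_)
  simp only [hz]

/-! ### The short-time Fourier transform of sequences -/

/-- The short-time Fourier transform `∑_k a(k) conj (M_w T_m b (k))` of a sequence `a` with
window `b`. -/
def seqStft (b a : Lattice n → ℂ) (z : Phase n) : ℂ :=
  ∑' k, a k * conj (shiftFun z.1 z.2 b k)

theorem seqStft_eq_tsum (b a : Lattice n → ℂ) (m : Lattice n) (w : Torus n) :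
    seqStft b a (m, w) = ∑' l, (a (-l) * conj (b (-l - m))) * mFourier l w := by
  rw [seqStft, ← (Equiv.neg (Lattice n)).tsum_eq]
  refine tsum_congr fun l => ?_
  simp only [Equiv.neg_apply, shiftFun, map_mul, mFourier_neg, RCLike.conj_conj]
  ring

theorem summable_seqStft_coeff {a b : Lattice n → ℂ} {m : Lattice n}
    (h : Summable fun k => ‖a k‖ * ‖b (k - m)‖) :
    Summable fun l => a (-l) * conj (b (-l - m)) := by
  refine Summable.of_norm ?_
  simpa [Function.comp_def] using (Equiv.neg (Lattice n)).summable_iff.mpr h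

theorem continuous_seqStft {a b : Lattice n → ℂ}
    (h : ∀ m, Summable fun k => ‖a k‖ * ‖b (k - m)‖) : Continuous (seqStft b a) := by
  refine continuous_prod_of_discrete_left.mpr fun m => ?_
  simp only [seqStft_eq_tsum]
  exact continuous_tsum_mFourier (summable_seqStft_coeff (h m))

theorem tsum_enorm_sq_sub (b : Lattice n → ℂ) (k : Lattice n) :
    ∑' m, ‖b (k - m)‖ₑ ^ 2 = ∑' m, ‖b m‖ₑ ^ 2 :=
  (Equiv.subLeft k).tsum_eq fun m => ‖b m‖ₑ ^ 2

/-- The orthogonality relation for the short-time Fourier transform. -/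
theorem lintegral_enorm_sq_seqStft {a b : Lattice n → ℂ}
    (h : ∀ m, Summable fun k => ‖a k‖ * ‖b (k - m)‖) :
    ∫⁻ z, ‖seqStft b a z‖ₑ ^ 2 ∂(phaseMeasure n) = (∑' k, ‖a k‖ₑ ^ 2) * ∑' k, ‖b k‖ₑ ^ 2 := by
  rw [lintegral_phase ((continuous_seqStft h).measurable.enorm.pow_const 2).aemeasurable]
  -- For fixed `m` the transform is a Fourier series in `w`, so Parseval applies; the sum over `m`
  -- then decouples `a` and `b`.
  have h1 : ∀ m, ∫⁻ w, ‖seqStft b a (m, w)‖ₑ ^ 2 ∂(torusMeasure n)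
      = ∑' k, ‖a k‖ₑ ^ 2 * ‖b (k - m)‖ₑ ^ 2 := by
    intro m
    simp only [seqStft_eq_tsum]
    rw [lintegral_enorm_sq_tsum_mFourier (summable_seqStft_coeff (h m)),
      ← (Equiv.neg (Lattice n)).tsum_eq]
    refine tsum_congr fun l => ?_
    simp only [Equiv.neg_apply, neg_neg, enorm_mul, RCLike.enorm_conj, mul_pow]
  simp only [h1]
  rw [ENNReal.tsum_comm]
  simp only [ENNReal.tsum_mul_left, tsum_enorm_sq_sub, ENNReal.tsum_mul_right]

/-- Up to conjugation of `b`, the product is a Fourier coefficient of `w ↦ seqStft b a (m, w)`. -/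
theorem enorm_mul_enorm_le_lintegral_seqStft {a b : Lattice n → ℂ} {m : Lattice n}
    (h : Summable fun k => ‖a k‖ * ‖b (k - m)‖) (k : Lattice n) :
    ‖a k‖ₑ * ‖b (k - m)‖ₑ ≤ ∫⁻ w, ‖seqStft b a (m, w)‖ₑ ∂(torusMeasure n) := by
  have h1 := integral_mFourier_mul_tsum (summable_seqStft_coeff h) (-k)
  simp only [neg_neg] at h1
  rw [← RCLike.enorm_conj (b (k - m)), ← enorm_mul, ← h1]
  refine (enorm_integral_le_lintegral_enorm _).trans (le_of_eq (lintegral_congr fun w => ?_))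
  rw [enorm_mul, enorm_mFourier_apply, one_mul, seqStft_eq_tsum]

/-! ### The short-time Fourier transform on `ℓ²(ℤⁿ)` -/

theorem stft_eq_seqStft (g f : L2Z n) : stft g f = seqStft g f := by
  funext z
  rw [stft, lp.inner_eq_tsum]
  exact tsum_congr fun k => RCLike.inner_apply _ _

theorem summable_norm_mul_norm_sub (g f : L2Z n) (m : Lattice n) :
    Summable fun k => ‖f k‖ * ‖g (k - m)‖ := by
  have h := (lp.summable_inner (𝕜 := ℂ) (shift m 0 g) f).norm
  refine h.congr fun k => ?_
  rw [RCLike.inner_apply, norm_mul, RCLike.norm_conj]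
  congr 1
  exact norm_shiftFun m 0 g k

theorem tsum_enorm_sq_eq {ι : Type*} (f : lp (fun _ : ι => ℂ) 2) : ∑' k, ‖f k‖ₑ ^ 2 = ‖f‖ₑ ^ 2 := by
  have h := lp.hasSum_norm (p := 2) (by norm_num) f
  simp only [ENNReal.toReal_ofNat, Real.rpow_ofNat] at h
  have e : ∀ x : ℝ, 0 ≤ x → ENNReal.ofReal x ^ 2 = ENNReal.ofReal (x ^ 2) := fun x hx => by
    rw [ENNReal.ofReal_pow hx]
  simp only [← ofReal_norm]
  simp only [e _ (norm_nonneg _)]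
  rw [← h.tsum_eq, ENNReal.ofReal_tsum_of_nonneg (fun _ => by positivity) h.summable]

theorem lintegral_enorm_sq_stft (g f : L2Z n) :
    ∫⁻ z, ‖stft g f z‖ₑ ^ 2 ∂(phaseMeasure n) = ‖f‖ₑ ^ 2 * ‖g‖ₑ ^ 2 := by
  rw [stft_eq_seqStft, lintegral_enorm_sq_seqStft (summable_norm_mul_norm_sub g f),
    tsum_enorm_sq_eq, tsum_enorm_sq_eq]

theorem enorm_shift (m : Lattice n) (w : Torus n) (f : L2Z n) : ‖shift m w f‖ₑ = ‖f‖ₑ := by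
  have h : ‖shift m w f‖ₑ ^ 2 = ‖f‖ₑ ^ 2 := by
    rw [← tsum_enorm_sq_eq, ← tsum_enorm_sq_eq,
      ← (Equiv.subRight m).tsum_eq fun k => ‖f k‖ₑ ^ 2]
    refine tsum_congr fun k => ?_
    rw [← ofReal_norm, ← ofReal_norm]
    congr 2
    exact (norm_shiftFun m w f k)
  exact (ENNReal.pow_right_strictMono two_ne_zero).injective h

theorem norm_shift (m : Lattice n) (w : Torus n) (f : L2Z n) : ‖shift m w f‖ = ‖f‖ := by
  rw [← toReal_enorm, enorm_shift, toReal_enorm]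

/-! ### Tempered distributions on the lattice -/

/-- Finite truncations of `φ` converge to it in the seminorm `p_N`: outside a ball of radius `R`,
the bound on `p_{N+1} φ` gains a factor `1 / (1 + R)`. Distributions on the lattice thereby become
sequences, to which the results on `seqStft` apply. -/
theorem TemperedZ.hasSum_coeff_mul (f : TemperedZ n) (φ : schwartzZ n) :
    HasSum (fun k => f.coeff k * (φ : Lattice n → ℂ) k) (f.toFun φ) := by
  classical
  obtain ⟨C, N, hC⟩ := f.continuous'
  obtain ⟨A, hA⟩ := φ.2 (N + 1)
  have hA0 : 0 ≤ A := le_trans (by positivity) (hA 0)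
  rw [HasSum, SummationFilter.unconditional_filter, Metric.tendsto_atTop]
  intro ε hε
  obtain ⟨R, hR⟩ := exists_nat_gt (|C| * A / ε)
  have hfin : (Metric.closedBall (0 : Lattice n) R).Finite :=
    (isCompact_closedBall _ _).finite_of_discrete
  refine ⟨hfin.toFinset, fun S hS => ?_⟩
  have hsum : ∑ k ∈ S, f.coeff k * (φ : Lattice n → ℂ) k
      = f.toFun (∑ k ∈ S, (φ : Lattice n → ℂ) k • deltaZ k) := by
    rw [map_sum]
    refine Finset.sum_congr rfl fun k _ => ?_
    rw [map_smul, smul_eq_mul, mul_comm]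
    rfl
  rw [hsum, dist_comm, dist_eq_norm, ← map_sub]
  have hval : ∀ j, ((φ - ∑ k ∈ S, (φ : Lattice n → ℂ) k • deltaZ k : schwartzZ n) :
      Lattice n → ℂ) j = if j ∈ S then 0 else (φ : Lattice n → ℂ) j := by
    intro j
    have h1 : ((∑ k ∈ S, (φ : Lattice n → ℂ) k • deltaZ k : schwartzZ n) : Lattice n → ℂ) j
        = ∑ k ∈ S, (φ : Lattice n → ℂ) k * (Pi.single k 1 : Lattice n → ℂ) j := by
      rw [Submodule.coe_sum, Finset.sum_apply]
      rfl
    change (φ : Lattice n → ℂ) j - _ = _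
    rw [h1]
    simp only [Pi.single_apply, mul_ite, mul_one, mul_zero, Finset.sum_ite_eq]
    split_ifs <;> simp
  have hb := hC (φ - ∑ k ∈ S, (φ : Lattice n → ℂ) k • deltaZ k) (A / (1 + R)) fun j => by
    rw [hval]
    split_ifs with hj
    · simp only [norm_zero, mul_zero]; positivity
    · have hjR : (R : ℝ) < ‖j‖ := by
        by_contra hle
        exact hj (hS (hfin.mem_toFinset.mpr (by simpa using not_lt.mp hle)))
      rw [le_div_iff₀ (by positivity)]
      calc (1 + ‖j‖) ^ N * ‖(φ : Lattice n → ℂ) j‖ * (1 + R)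
          ≤ (1 + ‖j‖) ^ N * ‖(φ : Lattice n → ℂ) j‖ * (1 + ‖j‖) := by gcongr
        _ = (1 + ‖j‖) ^ (N + 1) * ‖(φ : Lattice n → ℂ) j‖ := by ring
        _ ≤ A := hA j
  refine hb.trans_lt ?_
  rw [div_lt_iff₀ hε] at hR
  have hR' : |C| * A < ε * (1 + R) := by nlinarith
  calc C * (A / (1 + R)) ≤ |C| * (A / (1 + R)) := by gcongr; exact le_abs_self C
    _ = |C| * A / (1 + R) := by ring
    _ < ε := by rwa [div_lt_iff₀ (by positivity)]

theorem TemperedZ.stft_eq_seqStft (g₀ : schwartzZ n) (f : TemperedZ n) :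
    f.stft g₀ = seqStft (g₀ : Lattice n → ℂ) f.coeff := by
  funext z
  exact (f.hasSum_coeff_mul _).tsum_eq.symm

theorem TemperedZ.summable_norm_coeff_mul (g₀ : schwartzZ n) (f : TemperedZ n) (m : Lattice n) :
    Summable fun k => ‖f.coeff k‖ * ‖(g₀ : Lattice n → ℂ) (k - m)‖ := by
  refine (f.hasSum_coeff_mul (conjShift m 0 g₀)).summable.norm.congr fun k => ?_
  rw [norm_mul]
  congr 1
  exact (RCLike.norm_conj _).trans (norm_shiftFun m 0 _ k)

theorem summable_prod_apply {α : Type*} {f : α → ℝ} (hf0 : ∀ a, 0 ≤ f a) (hf : Summable f) :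
    ∀ d : ℕ, Summable fun k : Fin d → α => ∏ i, f (k i)
  | 0 => Summable.of_finite
  | d + 1 => by
    refine (Fin.consEquiv fun _ => α).summable_iff.mp ?_
    refine (hf.mul_of_nonneg (summable_prod_apply hf0 hf d) hf0
      fun k => Finset.prod_nonneg fun i _ => hf0 _).congr fun p => ?_
    simp [Fin.consEquiv, Fin.prod_univ_succ]

theorem summable_norm_schwartzZ (g₀ : schwartzZ n) :
    Summable fun k => ‖(g₀ : Lattice n → ℂ) k‖ := by
  obtain ⟨A, hA⟩ := g₀.2 (n * 2)
  have h1 : Summable fun k : ℤ => ((1 + |(k : ℝ)|) ^ 2)⁻¹ := by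
    have h2 : Summable fun k : ℕ => ((1 + (k : ℝ)) ^ 2)⁻¹ := by
      have h3 := (summable_nat_add_iff 1).mpr (Real.summable_nat_pow_inv.mpr (one_lt_two))
      refine h3.congr fun k => ?_
      push_cast
      ring
    refine Summable.of_nat_of_neg ?_ ?_ <;> simpa using h2
  have hprod := summable_prod_apply (fun k => by positivity) h1 n
  refine Summable.of_nonneg_of_le (fun _ => norm_nonneg _) (fun k => ?_) (hprod.mul_left A)
  have h4 : ∏ i, (1 + |(k i : ℝ)|) ^ 2 ≤ (1 + ‖k‖) ^ (n * 2) := by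
    calc ∏ i, (1 + |(k i : ℝ)|) ^ 2 ≤ ∏ _i : Fin n, (1 + ‖k‖) ^ 2 := by
          refine Finset.prod_le_prod (fun i _ => by positivity) fun i _ => ?_
          have := norm_le_pi_norm k i
          rw [Int.norm_eq_abs] at this
          gcongr
      _ = _ := by rw [Finset.prod_const, Finset.card_univ, Fintype.card_fin, ← pow_mul, mul_comm]
  have h5 : 0 < ∏ i, (1 + |(k i : ℝ)|) ^ 2 := Finset.prod_pos fun i _ => by positivity
  rw [Finset.prod_inv_distrib, ← div_eq_mul_inv, le_div_iff₀ h5, mul_comm]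
  exact (mul_le_mul_of_nonneg_right h4 (norm_nonneg _)).trans (hA k)

/-! ### Young functions -/

theorem IsYoungFunction.map_mul_le {Φ : ℝ≥0∞ → ℝ≥0∞} (hΦ : IsYoungFunction Φ) {c : ℝ≥0}
    (hc : c ≤ 1) (x : ℝ≥0) : Φ ((c * x : ℝ≥0) : ℝ≥0∞) ≤ c * Φ x := by
  have h := hΦ.convex c (1 - c) x 0 (add_tsub_cancel_of_le hc)
  simpa [hΦ.map_zero] using h

theorem IsYoungFunction.monotone {Φ : ℝ≥0∞ → ℝ≥0∞} (hΦ : IsYoungFunction Φ) : Monotone Φ := by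
  intro x y hxy
  induction y with
  | top => simp [hΦ.map_top]
  | coe y =>
    lift x to ℝ≥0 using ne_top_of_le_ne_top ENNReal.coe_ne_top hxy
    have hxy' : x ≤ y := ENNReal.coe_le_coe.mp hxy
    rcases eq_or_ne y 0 with rfl | hy
    · rw [nonpos_iff_eq_zero.mp hxy']
    · have h := hΦ.map_mul_le (c := x / y) (div_le_one_of_le₀ hxy' zero_le) y
      rw [div_mul_cancel₀ x hy] at h
      refine h.trans (mul_le_of_le_one_left zero_le ?_)
      exact_mod_cast div_le_one_of_le₀ hxy' zero_le

/-- The threshold `2/9` is what makes `(3/2) e^{-3/2} ≥ 1/3` in `le_young_of_le`. -/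
theorem two_ninths_le_exp : (2 / 9 : ℝ) ≤ Real.exp (-3 / 2) := by
  have h1 : Real.exp (3 / 2) ^ 2 = Real.exp 1 ^ 3 := by
    rw [← Real.exp_nat_mul, ← Real.exp_nat_mul]
    norm_num
  have h2 : Real.exp 1 ^ 3 ≤ (2.7182818286 : ℝ) ^ 3 :=
    pow_le_pow_left₀ (Real.exp_pos 1).le Real.exp_one_lt_d9.le 3
  have h3 : Real.exp (3 / 2) ≤ 9 / 2 := by
    refine abs_le_of_sq_le_sq' ?_ (by norm_num) |>.2
    rw [h1]
    exact h2.trans (by norm_num)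
  have h4 : Real.exp (-3 / 2) = (Real.exp (3 / 2))⁻¹ := by rw [← Real.exp_neg]; norm_num
  rw [h4, le_inv_comm₀ (by norm_num) (Real.exp_pos _)]
  exact h3.trans (by norm_num)

theorem exp_neg_le_one : Real.exp (-3 / 2) ≤ 1 := Real.exp_le_one_iff.mpr (by norm_num)

theorem sq_mul_le_neg_sq_mul_log {x : ℝ} (hx0 : 0 ≤ x) (hx : x ≤ Real.exp (-3 / 2)) :
    3 / 2 * x ^ 2 ≤ -(x ^ 2 * Real.log x) := by
  rcases hx0.eq_or_lt with rfl | hpos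
  · simp
  · have h : Real.log x ≤ -3 / 2 := by
      rw [← Real.log_exp (-3 / 2)]
      exact Real.log_le_log hpos hx
    nlinarith [sq_nonneg x]

section Entropy

variable {Φ : ℝ≥0∞ → ℝ≥0∞} (hΦ : IsYoungFunction Φ)
  (hlog : ∀ x : ℝ, 0 ≤ x → x ≤ Real.exp (-3 / 2) →
    Φ (ENNReal.ofReal x) = ENNReal.ofReal (-(x ^ 2 * Real.log x)))

include hlog in
theorem sq_le_young_of_le {x : ℝ≥0} (hx : (x : ℝ) ≤ Real.exp (-3 / 2)) :
    (x : ℝ≥0∞) ^ 2 ≤ Φ x := by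
  have h := hlog x x.2 hx
  rw [ENNReal.ofReal_coe_nnreal] at h
  rw [h, ← ENNReal.ofReal_coe_nnreal, ← ENNReal.ofReal_pow x.coe_nonneg]
  refine ENNReal.ofReal_le_ofReal ((?_ : (x : ℝ) ^ 2 ≤ 3 / 2 * x ^ 2).trans
    (sq_mul_le_neg_sq_mul_log x.2 hx))
  nlinarith [sq_nonneg (x : ℝ)]

include hΦ hlog in
-- With `t = e^{-3/2}`, convexity and `Φ(0) = 0` give `Φ(x) ≥ (x/t) Φ(t) = (3/2) t x ≥ x/3`.
theorem le_young_of_le {x : ℝ≥0} (hx : Real.exp (-3 / 2) ≤ x) : (x : ℝ≥0∞) ≤ 3 * Φ x := by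
  set t : ℝ≥0 := ⟨Real.exp (-3 / 2), (Real.exp_pos _).le⟩ with ht
  have htpos : 0 < t := Real.exp_pos _
  have hx' : t ≤ x := hx
  have hxpos : 0 < x := htpos.trans_le hx'
  have h1 := hlog t t.2 le_rfl
  rw [ENNReal.ofReal_coe_nnreal] at h1
  have h2 : ENNReal.ofReal (3 / 2 * (t : ℝ) ^ 2) ≤ Φ t := by
    rw [h1]
    exact ENNReal.ofReal_le_ofReal (sq_mul_le_neg_sq_mul_log t.2 le_rfl)
  have h3 := hΦ.map_mul_le (c := t / x) (div_le_one_of_le₀ hx' zero_le) x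
  rw [div_mul_cancel₀ t hxpos.ne'] at h3
  have h4 := h2.trans h3
  induction h : Φ x with
  | top => simp
  | coe y =>
    rw [h] at h4
    have h5 : 3 / 2 * (t : ℝ) ^ 2 ≤ t / x * y := by
      rw [← ENNReal.coe_mul, ← ENNReal.ofReal_coe_nnreal,
        ENNReal.ofReal_le_ofReal_iff (by positivity)] at h4
      simpa using h4
    have h6 : (2 / 9 : ℝ) ≤ t := two_ninths_le_exp
    have h7 : 0 < (x : ℝ) := hxpos
    have h8 : 0 < (t : ℝ) := htpos
    have h9 : (x : ℝ) ≤ 3 * y := by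
      rw [div_mul_eq_mul_div (t : ℝ), le_div_iff₀ h7] at h5
      have h10 : 3 / 2 * (t : ℝ) * x ≤ y := by nlinarith
      nlinarith
    have h11 : x ≤ 3 * y := by exact_mod_cast h9
    exact_mod_cast h11

include hΦ hlog in
theorem le_one_add_young (x : ℝ≥0) : (x : ℝ≥0∞) ≤ 1 + 3 * Φ x := by
  rcases le_total (x : ℝ) (Real.exp (-3 / 2)) with hx | hx
  · have h : x ≤ 1 := by exact_mod_cast hx.trans exp_neg_le_one
    exact le_add_right (by exact_mod_cast h)
  · exact le_add_left (le_young_of_le hΦ hlog hx)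

include hΦ hlog in
-- `Φ` may grow only linearly, so a quadratic lower bound is available only below a cutoff `M` and
-- degrades with it.
theorem sq_le_max_mul_young {x : ℝ≥0} {M : ℝ≥0∞} (hx : (x : ℝ≥0∞) ≤ M) :
    (x : ℝ≥0∞) ^ 2 ≤ max 1 (3 * M) * Φ x := by
  rcases le_total (x : ℝ) (Real.exp (-3 / 2)) with h | h
  · calc (x : ℝ≥0∞) ^ 2 ≤ 1 * Φ x := by rw [one_mul]; exact sq_le_young_of_le hlog h
      _ ≤ _ := by gcongr; exact le_max_left _ _
  · calc (x : ℝ≥0∞) ^ 2 = x * x := sq _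
      _ ≤ M * (3 * Φ x) := mul_le_mul' hx (le_young_of_le hΦ hlog h)
      _ = 3 * M * Φ x := by ring
      _ ≤ _ := by gcongr; exact le_max_right _ _

end Entropy

theorem enorm_div_coe {b : ℝ≥0} (hb : b ≠ 0) (z : ℂ) :
    ‖z‖ₑ / b = ((‖z‖₊ / b : ℝ≥0) : ℝ≥0∞) := by
  rw [ENNReal.coe_div hb]
  rfl

/-! ### Consequences of `∫ Φ(|F| / b) ≤ 1` -/

section Bounds

variable {Φ : ℝ≥0∞ → ℝ≥0∞} (hΦ : IsYoungFunction Φ)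
  (hlog : ∀ x : ℝ, 0 ≤ x → x ≤ Real.exp (-3 / 2) →
    Φ (ENNReal.ofReal x) = ENNReal.ofReal (-(x ^ 2 * Real.log x)))
  {F : Phase n → ℂ} {b : ℝ≥0} (hb : 0 < b)
  (hF : ∫⁻ z, Φ (‖F z‖ₑ / b) ∂(phaseMeasure n) ≤ 1)

include hΦ hlog hb hF in
-- Each fibre has mass one, so `x ≤ 1 + 3 Φ(x)` integrates to the bound `1 + 3 = 4`.
theorem lintegral_fiber_le (hFm : Measurable F) (m : Lattice n) :
    ∫⁻ w, ‖F (m, w)‖ₑ ∂(torusMeasure n) ≤ 4 * b := by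
  have hb0 : (b : ℝ≥0∞) ≠ 0 := by exact_mod_cast hb.ne'
  have hm : Measurable fun z => Φ (‖F z‖ₑ / b) :=
    hΦ.monotone.measurable.comp (hFm.enorm.div_const _)
  rw [lintegral_phase hm.aemeasurable] at hF
  have h1 : ∫⁻ w, Φ (‖F (m, w)‖ₑ / b) ∂(torusMeasure n) ≤ 1 := (ENNReal.le_tsum m).trans hF
  calc ∫⁻ w, ‖F (m, w)‖ₑ ∂(torusMeasure n)
      ≤ ∫⁻ w, b * (1 + 3 * Φ (‖F (m, w)‖ₑ / b)) ∂(torusMeasure n) := by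
        refine lintegral_mono fun w => ?_
        have h2 := le_one_add_young hΦ hlog (‖F (m, w)‖₊ / b)
        rw [← enorm_div_coe hb.ne'] at h2
        rwa [ENNReal.div_le_iff' hb0 ENNReal.coe_ne_top] at h2
    _ = b * (1 + 3 * ∫⁻ w, Φ (‖F (m, w)‖ₑ / b) ∂(torusMeasure n)) := by
        rw [lintegral_const_mul' _ _ ENNReal.coe_ne_top, lintegral_add_left measurable_const,
          lintegral_const_mul' _ _ (by norm_num)]
        simp
    _ ≤ b * (1 + 3 * 1) := by gcongr
    _ = 4 * b := by rw [mul_comm]; norm_num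

include hΦ hlog hb hF in
theorem lintegral_enorm_sq_le {M : ℝ≥0∞} (hM : M ≠ ⊤) (hFM : ∀ z, ‖F z‖ₑ ≤ b * M) :
    ∫⁻ z, ‖F z‖ₑ ^ 2 ∂(phaseMeasure n) ≤ b ^ 2 * max 1 (3 * M) := by
  have hb0 : (b : ℝ≥0∞) ≠ 0 := by exact_mod_cast hb.ne'
  have hmax : max 1 (3 * M) ≠ ⊤ :=
    (max_lt ENNReal.one_lt_top (ENNReal.mul_lt_top (by norm_num) hM.lt_top)).ne
  calc ∫⁻ z, ‖F z‖ₑ ^ 2 ∂(phaseMeasure n)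
      ≤ ∫⁻ z, b ^ 2 * max 1 (3 * M) * Φ (‖F z‖ₑ / b) ∂(phaseMeasure n) := by
        refine lintegral_mono fun z => ?_
        have h1 : ((‖F z‖₊ / b : ℝ≥0) : ℝ≥0∞) ≤ M := by
          rw [← enorm_div_coe hb.ne', ENNReal.div_le_iff' hb0 ENNReal.coe_ne_top]
          exact hFM z
        have h2 := sq_le_max_mul_young hΦ hlog h1
        rw [← enorm_div_coe hb.ne'] at h2
        have h3 : ‖F z‖ₑ = b * (‖F z‖ₑ / b) :=
          (ENNReal.mul_div_cancel hb0 ENNReal.coe_ne_top).symm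
        calc ‖F z‖ₑ ^ 2 = b ^ 2 * (‖F z‖ₑ / b) ^ 2 := by rw [← mul_pow, ← h3]
          _ ≤ b ^ 2 * (max 1 (3 * M) * Φ (‖F z‖ₑ / b)) := by gcongr
          _ = _ := by ring
    _ = b ^ 2 * max 1 (3 * M) * ∫⁻ z, Φ (‖F z‖ₑ / b) ∂(phaseMeasure n) :=
        lintegral_const_mul' _ _ (ENNReal.mul_ne_top (by simp) hmax)
    _ ≤ b ^ 2 * max 1 (3 * M) := mul_le_of_le_one_right' hF

end Bounds

/-! ### The embedding of `M^Φ` in `ℓ²` -/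

theorem memℓp_two_of_tsum_enorm_sq_ne_top {a : Lattice n → ℂ} (h : ∑' k, ‖a k‖ₑ ^ 2 ≠ ⊤) :
    Memℓp a 2 := by
  refine memℓp_gen ?_
  have h1 := ENNReal.summable_toReal h
  simpa using h1

theorem memℓp_two_schwartzZ (g₀ : schwartzZ n) : Memℓp (g₀ : Lattice n → ℂ) 2 := by
  have h : Memℓp (g₀ : Lattice n → ℂ) 1 :=
    memℓp_gen (by simpa using summable_norm_schwartzZ g₀)
  exact h.of_exponent_ge (by norm_num)

/-- A Schwartz function as an element of `ℓ²(ℤⁿ)`. -/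
def schwartzL2 (g₀ : schwartzZ n) : L2Z n := ⟨(g₀ : Lattice n → ℂ), memℓp_two_schwartzZ g₀⟩

theorem continuous_temperedStft (g₀ : schwartzZ n) (f : TemperedZ n) : Continuous (f.stft g₀) := by
  rw [f.stft_eq_seqStft]
  exact continuous_seqStft (f.summable_norm_coeff_mul g₀)

theorem enorm_temperedStft_le (g₀ : schwartzZ n) (f : TemperedZ n) {K : ℝ≥0∞}
    (hK : ∀ k, ‖f.coeff k‖ₑ ≤ K) (z : Phase n) :
    ‖f.stft g₀ z‖ₑ ≤ K * ∑' k, ‖(g₀ : Lattice n → ℂ) k‖ₑ := by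
  rw [f.stft_eq_seqStft, seqStft, ← ENNReal.tsum_mul_left]
  refine enorm_tsum_le_tsum_enorm.trans ?_
  rw [← (Equiv.subRight z.1).tsum_eq fun k => K * ‖(g₀ : Lattice n → ℂ) k‖ₑ]
  refine ENNReal.tsum_le_tsum fun k => ?_
  rw [enorm_mul, RCLike.enorm_conj]
  have h : ‖shiftFun z.1 z.2 (g₀ : Lattice n → ℂ) k‖ₑ = ‖(g₀ : Lattice n → ℂ) (k - z.1)‖ₑ := by
    rw [← ofReal_norm, norm_shiftFun, ofReal_norm]
  rw [h]
  exact mul_le_mul_left (hK k) _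

section Embedding

variable {Φ : ℝ≥0∞ → ℝ≥0∞} (hΦ : IsYoungFunction Φ)
  (hlog : ∀ x : ℝ, 0 ≤ x → x ≤ Real.exp (-3 / 2) →
    Φ (ENNReal.ofReal x) = ENNReal.ofReal (-(x ^ 2 * Real.log x)))
  {g₀ : schwartzZ n} {f : TemperedZ n}

include hΦ hlog in
-- A bootstrap: the fibrewise `L¹` bound controls the coefficients of `f`, these bound the transform
-- uniformly because `g₀ ∈ ℓ¹`, and a bounded transform is in `L²`. Orthogonality returns `f.coeff ∈
-- ℓ²`.
theorem MemOrliczModulation.memℓp (hg₀ : g₀ ≠ 0) (hf : MemOrliczModulation g₀ Φ f) :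
    Memℓp f.coeff 2 := by
  simp only [MemOrliczModulation, orliczModulationNorm, orliczNorm, iInf_lt_iff] at hf
  obtain ⟨b, hb, hF, -⟩ := hf
  obtain ⟨j, hj⟩ : ∃ j, (g₀ : Lattice n → ℂ) j ≠ 0 := by
    by_contra! h
    exact hg₀ (Subtype.ext (funext h))
  have hj0 : ‖(g₀ : Lattice n → ℂ) j‖ₑ ≠ 0 := enorm_ne_zero.mpr hj
  have hb0 : (b : ℝ≥0∞) ≠ 0 := by exact_mod_cast hb.ne'
  -- At `m = k - j` the coefficient of `f` at `k` meets the nonzero value `g₀ j`.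
  set K : ℝ≥0∞ := 4 * b / ‖(g₀ : Lattice n → ℂ) j‖ₑ with hKdef
  have hKtop : K ≠ ⊤ := ENNReal.div_ne_top (ENNReal.mul_ne_top (by norm_num) (by simp)) hj0
  have hK : ∀ k, ‖f.coeff k‖ₑ ≤ K := by
    intro k
    have h1 := enorm_mul_enorm_le_lintegral_seqStft (f.summable_norm_coeff_mul g₀ (k - j)) k
    rw [← f.stft_eq_seqStft, sub_sub_cancel] at h1
    rw [hKdef, ENNReal.le_div_iff_mul_le (Or.inl hj0) (Or.inl enorm_ne_top)]
    exact h1.trans (lintegral_fiber_le hΦ hlog hb hF (continuous_temperedStft g₀ f).measurable _)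
  have hS : ∑' k, ‖(g₀ : Lattice n → ℂ) k‖ₑ ≠ ⊤ := by
    have h := (summable_norm_schwartzZ g₀).tsum_ofReal_ne_top
    simpa only [ofReal_norm] using h
  have h1 := lintegral_enorm_sq_le hΦ hlog hb hF
    (M := K * (∑' k, ‖(g₀ : Lattice n → ℂ) k‖ₑ) / b)
    (ENNReal.div_ne_top (ENNReal.mul_ne_top hKtop hS) hb0) fun z => by
      rw [ENNReal.mul_div_cancel hb0 ENNReal.coe_ne_top]
      exact enorm_temperedStft_le g₀ f hK z
  rw [f.stft_eq_seqStft, lintegral_enorm_sq_seqStft (f.summable_norm_coeff_mul g₀)] at h1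
  refine memℓp_two_of_tsum_enorm_sq_ne_top fun htop => ?_
  have hg0 : ∑' k, ‖(g₀ : Lattice n → ℂ) k‖ₑ ^ 2 ≠ 0 := fun h =>
    hj0 (pow_eq_zero_iff two_ne_zero |>.mp (ENNReal.tsum_eq_zero.mp h j))
  rw [htop, ENNReal.top_mul hg0, top_le_iff] at h1
  refine ENNReal.mul_ne_top (by simp) ?_ h1
  exact (max_lt ENNReal.one_lt_top (ENNReal.mul_lt_top (by norm_num)
    (ENNReal.div_ne_top (ENNReal.mul_ne_top hKtop hS) hb0).lt_top)).ne

include hΦ hlog in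
-- Put `Y = ‖γ‖ ‖g₀‖`. Cauchy-Schwarz bounds the transform by `Y`, while orthogonality makes its
-- squared `L²` norm equal to `Y²`. Hence `Y² ≤ b² max(1, 3Y/b)`, which forces `Y ≤ 3b` for each
-- admissible `b`.
theorem enorm_mul_enorm_le_orliczModulationNorm {γ : L2Z n} (hγ : ∀ k, γ k = f.coeff k) :
    ‖γ‖ₑ * ‖schwartzL2 g₀‖ₑ ≤ 3 * orliczModulationNorm g₀ Φ f := by
  rw [mul_comm 3, ← ENNReal.div_le_iff_le_mul (by simp) (by simp)]
  simp only [orliczModulationNorm, orliczNorm, le_iInf_iff]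
  intro b hb hF
  rw [ENNReal.div_le_iff_le_mul (by simp) (by simp)]
  have hb0 : (b : ℝ≥0∞) ≠ 0 := by exact_mod_cast hb.ne'
  have hst : f.stft g₀ = stft (schwartzL2 g₀) γ := by
    rw [f.stft_eq_seqStft, stft_eq_seqStft]
    exact congrArg (seqStft (g₀ : Lattice n → ℂ)) (funext hγ).symm
  rw [hst] at hF
  set Y : ℝ≥0 := ‖γ‖₊ * ‖schwartzL2 g₀‖₊ with hY
  have hYe : ‖γ‖ₑ * ‖schwartzL2 g₀‖ₑ = Y := by rw [hY, ENNReal.coe_mul]; rfl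
  have h1 := lintegral_enorm_sq_le hΦ hlog hb hF (M := Y / b)
    (ENNReal.div_ne_top (by simp) hb0) fun z => by
      rw [ENNReal.mul_div_cancel hb0 ENNReal.coe_ne_top, ← hYe, stft, mul_comm,
        ← enorm_shift z.1 z.2 (schwartzL2 g₀)]
      simp only [← ofReal_norm]
      rw [← ENNReal.ofReal_mul (norm_nonneg _)]
      exact ENNReal.ofReal_le_ofReal (norm_inner_le_norm _ _)
  rw [lintegral_enorm_sq_stft, ← mul_pow, hYe, ← ENNReal.coe_div hb.ne'] at h1
  rw [hYe]
  have h2 : Y ^ 2 ≤ b ^ 2 * max 1 (3 * (Y / b)) := by exact_mod_cast h1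
  have h3 : Y ≤ b * 3 := by
    by_contra! hlt
    have h4 : (1 : ℝ≥0) ≤ 3 * (Y / b) := by
      rw [← mul_div_assoc, le_div_iff₀ hb, one_mul]
      have : (b : ℝ) * 3 < Y := hlt
      have h5 : (b : ℝ) ≤ 3 * Y := by nlinarith [b.2, Y.2]
      exact_mod_cast h5
    rw [max_eq_right h4] at h2
    have h6 : b ^ 2 * (3 * (Y / b)) = b * 3 * Y := by field_simp
    rw [h6, sq] at h2
    have hYpos : 0 < Y := lt_of_le_of_lt zero_le hlt
    exact absurd (le_of_mul_le_mul_right h2 hYpos) (not_le.mpr hlt)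
  exact_mod_cast h3

end Embedding

universe u

/-! ### Eigenbases of positive compact operators -/

section Hilbert

variable {H : Type u} [NormedAddCommGroup H] [InnerProductSpace ℂ H]

theorem tsum_enorm_inner_sq {ι : Type*} (b : HilbertBasis ι ℂ H) (x : H) :
    ∑' i, ‖⟪b i, x⟫_ℂ‖ₑ ^ 2 = ‖x‖ₑ ^ 2 := by
  simp only [← b.repr_apply_apply]
  rw [tsum_enorm_sq_eq, ← ofReal_norm, b.repr.norm_map, ofReal_norm]

/-- Each `e k` has countably many nonzero coefficients, and no `b i` is orthogonal to all `e k`.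
Countability is needed to exchange the trace sum with an integral. -/
theorem countable_of_hilbertBasis {ι κ : Type*} [Countable κ] (b : HilbertBasis ι ℂ H)
    (e : HilbertBasis κ ℂ H) : Countable ι := by
  have h1 : ∀ k, {i | ⟪b i, e k⟫_ℂ ≠ 0}.Countable := by
    intro k
    have h2 : ∑' i, ‖⟪b i, e k⟫_ℂ‖ₑ ^ 2 ≠ ⊤ := by
      rw [tsum_enorm_inner_sq]
      exact ENNReal.pow_ne_top enorm_ne_top
    refine (Summable.countable_support_ennreal h2).mono fun i hi => ?_
    simpa using hi
  have h3 : (Set.univ : Set ι) ⊆ ⋃ k, {i | ⟪b i, e k⟫_ℂ ≠ 0} := by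
    intro i _
    by_contra h
    simp only [Set.mem_iUnion, Set.mem_ofPred_eq, not_exists, not_not] at h
    have h4 := tsum_enorm_inner_sq e (b i)
    have h5 : ∀ k, ⟪e k, b i⟫_ℂ = 0 := fun k => by
      rw [← inner_conj_symm, h k, map_zero]
    have h6 : b i = 0 := by simpa [h5] using h4.symm
    simpa [h6] using b.orthonormal.1 i
  exact Set.countable_univ_iff.mp ((Set.countable_iUnion h1).mono h3)

variable [CompleteSpace H]

/-- A positive compact operator has an orthonormal basis of eigenvectors, and the sum of its
singular values is the sum of the eigenvalues. -/
theorem exists_eigenbasis {T : H →L[ℂ] H} (hT : IsCompactOperator T) (hpos : T.IsPositive) :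
    ∃ (ι : Type u) (b : HilbertBasis ι ℂ H),
      schattenOneNorm T = ∑' i, ENNReal.ofReal (⟪b i, T (b i)⟫_ℂ).re := by
  have hsymm : (T : H →ₗ[ℂ] H).IsSymmetric := hpos.isSymmetric
  set E : ℂ → Submodule ℂ H := fun μ => Module.End.eigenspace (T : H →ₗ[ℂ] H) μ with hE
  have hmem : ∀ μ x, x ∈ E μ ↔ T x = μ • x := fun μ x => Module.End.mem_eigenspace_iff
  have hclosed : ∀ μ, IsClosed (E μ : Set H) := by
    intro μ
    have : (E μ : Set H) = {x | T x = μ • x} := Set.ext (hmem μ)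
    rw [this]
    exact isClosed_eq T.continuous (continuous_const_smul μ)
  have : ∀ μ, CompleteSpace (E μ) := fun μ => (hclosed μ).completeSpace_coe
  -- The eigenbasis collects Hilbert bases of all eigenspaces, the kernel included; vectors with
  -- eigenvalue 0 add nothing to the sum.
  choose W B hB using fun μ : ℂ => exists_hilbertBasis ℂ (E μ)
  have hfam : OrthogonalFamily ℂ (fun μ => E μ) fun μ => (E μ).subtypeₗᵢ :=
    hsymm.orthogonalFamily_eigenspaces
  have horth : Orthonormal ℂ fun a : Σ μ, W μ => ((B a.1 a.2 : E a.1) : H) :=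
    hfam.orthonormal_sigma_orthonormal (v_family := fun μ => B μ) fun μ => (B μ).orthonormal
  have hdense : (Submodule.span ℂ (Set.range fun a : Σ μ, W μ => ((B a.1 a.2 : E a.1) : H)))ᗮ
      = ⊥ := by
    rw [eq_bot_iff, ← T.orthogonalComplement_iSup_eigenspaces_eq_bot hT hsymm]
    intro x hx
    have hx' : ∀ (μ : ℂ) (w : W μ), ⟪((B μ w : E μ) : H), x⟫_ℂ = 0 := fun μ w =>
      hx _ (Submodule.subset_span ⟨⟨μ, w⟩, rfl⟩)
    have hle : ⨆ μ, E μ ≤ LinearMap.ker (innerSL ℂ x).toLinearMap := by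
      refine iSup_le fun μ y hy => ?_
      have hyB := (B μ).hasSum_repr ⟨y, hy⟩
      have hyH : HasSum (fun w => (B μ).repr ⟨y, hy⟩ w • ((B μ w : E μ) : H)) y :=
        hyB.mapL (E μ).subtypeL
      have h1 := hyH.mapL (innerSL ℂ x)
      simp only [innerSL_apply_apply, inner_smul_right] at h1
      have h2 : ∀ w, ⟪x, ((B μ w : E μ) : H)⟫_ℂ = 0 := fun w => by
        rw [← inner_conj_symm, hx' μ w, map_zero]
      simp only [h2, mul_zero] at h1
      exact h1.unique hasSum_zero
    rw [Submodule.mem_orthogonal']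
    exact fun y hy => hle hy
  refine ⟨Σ μ, W μ, HilbertBasis.mkOfOrthogonalEqBot horth hdense, ?_⟩
  have hval : ∀ a : Σ μ, W μ, (⟪((B a.1 a.2 : E a.1) : H), T ((B a.1 a.2 : E a.1) : H)⟫_ℂ).re
      = a.1.re := by
    intro a
    rw [(hmem a.1 _).mp (B a.1 a.2).2, inner_smul_right, inner_self_eq_norm_sq_to_K,
      horth.1 a]
    simp
  simp only [HilbertBasis.coe_mkOfOrthogonalEqBot, hval]
  rw [ENNReal.tsum_sigma' fun a : Σ μ, W μ => ENNReal.ofReal a.1.re]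
  have habs : CFC.abs T = T := CFC.abs_of_nonneg T ((T.nonneg_iff_isPositive).mpr hpos)
  rw [schattenOneNorm, habs]
  have hinj : Function.Injective fun μ : {μ : ℝ // 0 < μ} => ((μ : ℝ) : ℂ) :=
    Complex.ofReal_injective.comp Subtype.val_injective
  rw [← hinj.tsum_eq (f := fun μ : ℂ => ∑' w : W μ, ENNReal.ofReal μ.re)]
  · refine tsum_congr fun μ => ?_
    have hne : ((μ : ℝ) : ℂ) ≠ 0 := Complex.ofReal_ne_zero.mpr μ.2.ne'
    -- Compactness matters here: `finrank` would be 0 on an infinite-dimensional eigenspace.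
    have : FiniteDimensional ℂ (E (μ : ℝ)) := T.finite_dimensional_eigenspace hT _ hne
    have : Finite (W (μ : ℝ)) := (B (μ : ℝ)).orthonormal.linearIndependent.finite
    have := Fintype.ofFinite (W (μ : ℝ))
    have hcard : Module.finrank ℂ (E (μ : ℝ)) = Fintype.card (W (μ : ℝ)) :=
      Module.finrank_eq_card_basis (B (μ : ℝ)).toOrthonormalBasis.toBasis
    change ENNReal.ofReal μ * (Module.finrank ℂ (E (μ : ℝ)) : ℝ≥0∞) = _
    rw [hcard, tsum_fintype, Finset.sum_const, Finset.card_univ, nsmul_eq_mul, mul_comm,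
      Complex.ofReal_re]
  -- `ENNReal.ofReal` discards eigenvalues whose real part is not positive, and symmetry makes
  -- eigenvalues real, so only positive real `μ` contribute.
  · intro μ hμ
    rw [Function.mem_support] at hμ
    obtain ⟨w, hw⟩ : ∃ w : W μ, ENNReal.ofReal μ.re ≠ 0 := by
      by_contra! h
      exact hμ (ENNReal.tsum_eq_zero.mpr h)
    have hev : Module.End.HasEigenvalue (T : H →ₗ[ℂ] H) μ := by
      refine Module.End.hasEigenvalue_of_hasEigenvector (x := ((B μ w : E μ) : H))
        ⟨(B μ w).2, fun h0 => ?_⟩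
      simpa [h0] using horth.1 ⟨μ, w⟩
    have hreal := hsymm.conj_eigenvalue_eq_self hev
    have hre : ((μ.re : ℝ) : ℂ) = μ := Complex.conj_eq_iff_re.mp hreal
    exact ⟨⟨μ.re, by simpa using hw⟩, hre⟩

end Hilbert

/-! ### Integrals of rank one operators -/

section Frame

variable {H : Type*} [NormedAddCommGroup H] [InnerProductSpace ℂ H] [CompleteSpace H]
  {X : Type*} [MeasurableSpace X] {μ : Measure X} {s : X → ℝ} {v : X → H} {c : ℝ}

/-- The operator `f ↦ ∫ s(x) ⟨v(x), f⟩ v(x) dμ(x)`. -/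
def frameOperator (μ : Measure X) (s : X → ℝ) (v : X → H) : H →L[ℂ] H :=
  ∫ x, (s x : ℂ) • InnerProductSpace.rankOne ℂ (v x) (v x) ∂μ

variable (hs : Integrable s μ) (hv : AEStronglyMeasurable v μ) (hc : ∀ x, ‖v x‖ = c)

include hs hv hc

theorem integrable_smul_rankOne :
    Integrable (fun x => (s x : ℂ) • InnerProductSpace.rankOne ℂ (v x) (v x)) μ := by
  refine Integrable.mono' (hs.norm.mul_const (c * c)) ?_ (Eventually.of_forall fun x => ?_)
  · refine (Complex.continuous_ofReal.comp_aestronglyMeasurable hs.1).smul ?_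
    have hcont : Continuous fun y : H => InnerProductSpace.rankOne ℂ y y := by
      have h1 : Continuous fun y : H => ContinuousLinearMap.toSpanSingleton ℂ y :=
        (ContinuousLinearMap.toSpanSingletonCLE (𝕜 := ℂ) (E := H)).continuous
      simp only [InnerProductSpace.rankOne_def']
      exact h1.clm_comp (innerSL ℂ).continuous
    exact hcont.comp_aestronglyMeasurable hv
  · rw [norm_smul, InnerProductSpace.norm_rankOne, hc, Complex.norm_real]

theorem integrable_smul_inner_smul (f : H) :
    Integrable (fun x => (s x : ℂ) • ⟪v x, f⟫_ℂ • v x) μ :=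
  (integrable_smul_rankOne hs hv hc).apply_continuousLinearMap f

theorem frameOperator_apply (f : H) :
    frameOperator μ s v f = ∫ x, (s x : ℂ) • ⟪v x, f⟫_ℂ • v x ∂μ :=
  ContinuousLinearMap.integral_apply (integrable_smul_rankOne hs hv hc) f

theorem integrable_mul_norm_inner_sq (f : H) : Integrable (fun x => s x * ‖⟪v x, f⟫_ℂ‖ ^ 2) μ := by
  have h := (Integrable.const_inner (𝕜 := ℂ) f (integrable_smul_inner_smul hs hv hc f)).re
  refine h.congr (Eventually.of_forall fun x => ?_)
  simp only [inner_smul_right]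
  rw [← inner_conj_symm f (v x), Complex.mul_conj', ← Complex.ofReal_pow, ← Complex.ofReal_mul]
  exact Complex.ofReal_re _

theorem inner_frameOperator (f : H) :
    ⟪f, frameOperator μ s v f⟫_ℂ = ((∫ x, s x * ‖⟪v x, f⟫_ℂ‖ ^ 2 ∂μ : ℝ) : ℂ) := by
  rw [frameOperator_apply hs hv hc, ← integral_inner (𝕜 := ℂ) (integrable_smul_inner_smul hs hv hc f),
    ← integral_complex_ofReal]
  refine integral_congr_ae (Eventually.of_forall fun x => ?_)
  simp only [inner_smul_right]
  rw [← inner_conj_symm f (v x), Complex.mul_conj', ← Complex.ofReal_pow, ← Complex.ofReal_mul]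

/-- Compact operators form a closed subspace; the quotient map by it kills the integrand, hence the
Bochner integral. -/
theorem isCompactOperator_frameOperator : IsCompactOperator (frameOperator μ s v) := by
  set K : Submodule ℂ (H →L[ℂ] H) := compactOperator (RingHom.id ℂ) H H
  have hK : IsClosed (K : Set (H →L[ℂ] H)) := isClosed_setOfPred_isCompactOperator
  have hmem : ∀ x, (s x : ℂ) • InnerProductSpace.rankOne ℂ (v x) (v x) ∈ K := fun x =>
    K.smul_mem _ ((isCompactOperator_of_locallyCompactSpace_dom (innerSL ℂ (v x))).clm_comp
      (ContinuousLinearMap.toSpanSingleton ℂ (v x)))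
  have hint := integrable_smul_rankOne hs hv hc
  have h := K.mkQL.integral_comp_comm hint
  have h0 : ∀ x, K.mkQL ((s x : ℂ) • InnerProductSpace.rankOne ℂ (v x) (v x)) = 0 := fun x =>
    (Submodule.Quotient.mk_eq_zero K).mpr (hmem x)
  simp only [h0, integral_zero] at h
  exact (Submodule.Quotient.mk_eq_zero K).mp h.symm

variable (hs0 : ∀ᵐ x ∂μ, 0 ≤ s x)

include hs0

theorem enorm_inner_frameOperator (f : H) :
    ENNReal.ofReal (⟪f, frameOperator μ s v f⟫_ℂ).re = ∫⁻ x, ‖s x‖ₑ * ‖⟪v x, f⟫_ℂ‖ₑ ^ 2 ∂μ := by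
  rw [inner_frameOperator hs hv hc, Complex.ofReal_re,
    ofReal_integral_eq_lintegral_ofReal (integrable_mul_norm_inner_sq hs hv hc f)
      (hs0.mono fun x hx => by positivity)]
  refine lintegral_congr_ae (hs0.mono fun x hx => ?_)
  simp only
  rw [ENNReal.ofReal_mul hx, ENNReal.ofReal_pow (norm_nonneg _), ofReal_norm,
    Real.enorm_of_nonneg hx]

theorem isPositive_frameOperator : (frameOperator μ s v).IsPositive := by
  rw [ContinuousLinearMap.isPositive_iff_complex]
  intro f
  rw [← inner_conj_symm, inner_frameOperator hs hv hc, Complex.conj_ofReal]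
  refine ⟨by simp, ?_⟩
  change 0 ≤ ∫ x, s x * ‖⟪v x, f⟫_ℂ‖ ^ 2 ∂μ
  exact integral_nonneg_of_ae (hs0.mono fun x hx => mul_nonneg hx (by positivity))

/-- The trace in an eigenbasis is `∑ᵢ ∫ s |⟨v, bᵢ⟩|²`; Tonelli and Parseval turn it into `∫ s ‖v‖²`.
The basis `e` only certifies separability. -/
theorem schattenOneNorm_frameOperator {κ : Type*} [Countable κ] (e : HilbertBasis κ ℂ H) :
    schattenOneNorm (frameOperator μ s v) = ENNReal.ofReal c ^ 2 * ∫⁻ x, ‖s x‖ₑ ∂μ := by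
  obtain ⟨ι, b, hb⟩ := exists_eigenbasis (isCompactOperator_frameOperator hs hv hc)
    (isPositive_frameOperator hs hv hc hs0)
  have := countable_of_hilbertBasis b e
  rw [hb]
  simp only [enorm_inner_frameOperator hs hv hc hs0]
  rw [← lintegral_tsum]
  · simp only [ENNReal.tsum_mul_left]
    rw [← lintegral_const_mul' _ _ (by simp)]
    refine lintegral_congr fun x => ?_
    have h : ∀ i, ‖⟪v x, b i⟫_ℂ‖ₑ = ‖⟪b i, v x⟫_ℂ‖ₑ := fun i => by
      rw [← inner_conj_symm, RCLike.enorm_conj]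
    simp only [h]
    rw [tsum_enorm_inner_sq, ← ofReal_norm (v x), hc, mul_comm]
  · intro i
    exact hs.1.enorm.mul ((hv.inner aestronglyMeasurable_const).enorm.pow_const 2)

end Frame

/-! ### Localization operators with integrable symbols -/

/-- The standard basis of `ℓ²(ℤⁿ)`. -/
def standardBasis (n : ℕ) : HilbertBasis (Lattice n) ℂ (L2Z n) :=
  HilbertBasis.ofRepr (LinearIsometryEquiv.refl ℂ _)

theorem continuous_shift_apply (γ : L2Z n) (k : Lattice n) :
    Continuous fun z : Phase n => shift z.1 z.2 γ k :=
  continuous_prod_of_discrete_left.mpr fun m =>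
    (mFourier k).continuous.mul (continuous_const (y := γ (k - m)))

/-- Finite coordinate truncations are continuous in `z` and converge pointwise in `ℓ²`. -/
theorem stronglyMeasurable_shift (γ : L2Z n) :
    StronglyMeasurable fun z : Phase n => shift z.1 z.2 γ := by
  refine stronglyMeasurable_of_tendsto (atTop : Filter (Finset (Lattice n)))
    (f := fun S z => ∑ k ∈ S, lp.single 2 k (shift z.1 z.2 γ k)) (fun S => ?_) ?_
  · refine Continuous.stronglyMeasurable (continuous_finsetSum S fun k _ => ?_)
    exact (lp.singleContinuousLinearMap ℂ (fun _ : Lattice n => ℂ) 2 k).continuous.comp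
      (continuous_shift_apply γ k)
  · rw [tendsto_pi_nhds]
    intro z
    exact lp.hasSum_single (by norm_num) (shift z.1 z.2 γ)

/-- The localization operator with real symbol `s` and both windows equal to `γ`. -/
def localizationOperator (s : Phase n → ℝ) (γ : L2Z n) : L2Z n →L[ℂ] L2Z n :=
  frameOperator (phaseMeasure n) s fun z => shift z.1 z.2 γ

section Localization

variable {s : Phase n → ℝ} (hs : Integrable s (phaseMeasure n)) (γ : L2Z n)

include hs

/-- Evaluation at `k` is a continuous functional, so it commutes with the Bochner integral. -/
theorem isLocalizationOperator_localizationOperator :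
    IsLocalizationOperator (fun z => (s z : ℂ)) γ γ (localizationOperator s γ) := by
  intro f k
  have hint := integrable_smul_inner_smul hs (stronglyMeasurable_shift γ).aestronglyMeasurable
    (fun z => norm_shift z.1 z.2 γ) f
  have e : ∀ z : Phase n, lp.evalCLM ℂ (fun _ : Lattice n => ℂ) 2 k
      ((s z : ℂ) • ⟪shift z.1 z.2 γ, f⟫_ℂ • shift z.1 z.2 γ)
      = s z * stft γ f z * shift z.1 z.2 γ k := fun z => by
    rw [map_smul, map_smul, smul_eq_mul, smul_eq_mul, ← mul_assoc]
    rfl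
  constructor
  · have h := (lp.evalCLM ℂ (fun _ : Lattice n => ℂ) 2 k).integrable_comp hint
    simpa only [e] using h
  · rw [localizationOperator, frameOperator_apply hs
      (stronglyMeasurable_shift γ).aestronglyMeasurable (fun z => norm_shift z.1 z.2 γ)]
    have h := (lp.evalCLM ℂ (fun _ : Lattice n => ℂ) 2 k).integral_comp_comm hint
    simp only [e] at h
    exact h.symm

variable (hs0 : ∀ᵐ z ∂(phaseMeasure n), 0 ≤ s z)

include hs0

theorem schattenOneNorm_localizationOperator :
    schattenOneNorm (localizationOperator s γ)
      = ‖γ‖ₑ ^ 2 * ∫⁻ z, ‖s z‖ₑ ∂(phaseMeasure n) := by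
  rw [localizationOperator, schattenOneNorm_frameOperator hs
    (stronglyMeasurable_shift γ).aestronglyMeasurable (fun z => norm_shift z.1 z.2 γ) hs0
    (standardBasis n), ofReal_norm]

theorem isTraceClass_localizationOperator : IsTraceClass (localizationOperator s γ) := by
  refine ⟨isCompactOperator_frameOperator hs (stronglyMeasurable_shift γ).aestronglyMeasurable
    (fun z => norm_shift z.1 z.2 γ), ?_⟩
  rw [schattenOneNorm_localizationOperator hs γ hs0]
  exact ENNReal.mul_lt_top (by simp) hs.2

theorem enorm_lowerSymbol (z : Phase n) :
    ‖lowerSymbol (localizationOperator s γ) γ z‖ₑ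
      = ∫⁻ x, ‖s x‖ₑ * ‖stft γ (shift x.1 x.2 γ) z‖ₑ ^ 2 ∂(phaseMeasure n) := by
  have hv := (stronglyMeasurable_shift γ).aestronglyMeasurable (μ := phaseMeasure n)
  have hc : ∀ x : Phase n, ‖shift x.1 x.2 γ‖ = ‖γ‖ := fun x => norm_shift x.1 x.2 γ
  have h1 := inner_frameOperator hs hv hc (shift z.1 z.2 γ)
  have h2 := enorm_inner_frameOperator hs hv hc hs0 (shift z.1 z.2 γ)
  rw [h1, Complex.ofReal_re] at h2
  rw [lowerSymbol, localizationOperator, h1, ← ofReal_norm, Complex.norm_real, Real.norm_of_nonneg,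
    h2]
  · refine lintegral_congr fun x => ?_
    rw [stft, ← inner_conj_symm, RCLike.enorm_conj]
  · exact integral_nonneg_of_ae (hs0.mono fun x hx => mul_nonneg hx (by positivity))

/-- Tonelli moves the `z` integral inside, where orthogonality gives `‖γ‖⁴` for every `x`. -/
theorem lintegral_enorm_lowerSymbol :
    ∫⁻ z, ‖lowerSymbol (localizationOperator s γ) γ z‖ₑ ∂(phaseMeasure n)
      = schattenOneNorm (localizationOperator s γ) * ‖γ‖ₑ ^ 2 := by
  simp only [enorm_lowerSymbol hs γ hs0]
  have hm : AEMeasurable (Function.uncurry fun z x : Phase n =>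
      ‖s x‖ₑ * ‖stft γ (shift x.1 x.2 γ) z‖ₑ ^ 2) ((phaseMeasure n).prod (phaseMeasure n)) := by
    have h0 : AEMeasurable (fun p : Phase n × Phase n => ‖s p.2‖ₑ)
        ((phaseMeasure n).prod (phaseMeasure n)) := hs.1.enorm.comp_snd
    have h4 : Measurable fun p : Phase n × Phase n =>
        ‖stft γ (shift p.2.1 p.2.2 γ) p.1‖ₑ ^ 2 := by
      have h1 : StronglyMeasurable fun p : Phase n × Phase n => shift p.1.1 p.1.2 γ :=
        (stronglyMeasurable_shift γ).comp_measurable measurable_fst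
      have h2 : StronglyMeasurable fun p : Phase n × Phase n => shift p.2.1 p.2.2 γ :=
        (stronglyMeasurable_shift γ).comp_measurable measurable_snd
      exact (h1.inner (𝕜 := ℂ) h2).measurable.enorm.pow_const 2
    exact h0.mul h4.aemeasurable
  rw [lintegral_lintegral_swap hm, schattenOneNorm_localizationOperator hs γ hs0]
  have h3 : ∀ x : Phase n, ∫⁻ z, ‖s x‖ₑ * ‖stft γ (shift x.1 x.2 γ) z‖ₑ ^ 2 ∂(phaseMeasure n)
      = ‖s x‖ₑ * (‖γ‖ₑ ^ 2 * ‖γ‖ₑ ^ 2) := fun x => by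
    rw [lintegral_const_mul' _ _ enorm_ne_top, lintegral_enorm_sq_stft, enorm_shift]
  simp only [h3]
  rw [lintegral_mul_const' _ _ (ENNReal.mul_ne_top (by simp) (by simp))]
  ring

theorem integrable_lowerSymbol :
    Integrable (lowerSymbol (localizationOperator s γ) γ) (phaseMeasure n) := by
  constructor
  · have h1 := stronglyMeasurable_shift γ
    exact (h1.inner (𝕜 := ℂ)
      ((localizationOperator s γ).continuous.comp_stronglyMeasurable h1)).aestronglyMeasurable
  · rw [HasFiniteIntegral, lintegral_enorm_lowerSymbol hs γ hs0]
    exact ENNReal.mul_lt_top (isTraceClass_localizationOperator hs γ hs0).2 (by simp)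

end Localization

/-! ### Constants -/

theorem enorm_schwartzL2_sq (g₀ : schwartzZ n) :
    ‖schwartzL2 g₀‖ₑ ^ 2 = ENNReal.ofReal (∑' k, ‖(g₀ : Lattice n → ℂ) k‖ ^ 2) := by
  have h := lp.hasSum_norm (p := 2) (by norm_num) (schwartzL2 g₀)
  simp only [ENNReal.toReal_ofNat, Real.rpow_ofNat] at h
  rw [← ofReal_norm, ← ENNReal.ofReal_pow (norm_nonneg _), ← h.tsum_eq]
  rfl

theorem schwartzL2_ne_zero {g₀ : schwartzZ n} (hg₀ : g₀ ≠ 0) : schwartzL2 g₀ ≠ 0 := fun h =>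
  hg₀ (Subtype.ext (congrArg (fun x : L2Z n => (x : Lattice n → ℂ)) h))

/-- A constant that compares the norms of `ℓ²` and `L¹` with the modulation space norms. -/
theorem exists_modulation_constant (g₀ : schwartzZ n) (hg₀ : g₀ ≠ 0) (h₀ : Phase n → ℂ)
    (hh₀ : h₀ ≠ 0) :
    ∃ C : ℝ≥0, 0 < C ∧
      (9 ≤ ∑' k, ‖(g₀ : Lattice n → ℂ) k‖ ^ 2 → (∃ z, 1 ≤ ‖h₀ z‖) → C = 1) ∧
      ∃ u, 9 ≤ C * ‖schwartzL2 g₀‖ₑ ^ 2 ∧ 9 ≤ C * ‖schwartzL2 g₀‖ₑ ^ 2 * ‖h₀ u‖ₑ := by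
  by_cases hcond : 9 ≤ ∑' k, ‖(g₀ : Lattice n → ℂ) k‖ ^ 2 ∧ ∃ z, 1 ≤ ‖h₀ z‖
  · obtain ⟨h9, z, hz⟩ := hcond
    have h1 : 9 ≤ ‖schwartzL2 g₀‖ₑ ^ 2 := by
      rw [enorm_schwartzL2_sq, ← ENNReal.ofReal_ofNat]
      exact ENNReal.ofReal_le_ofReal h9
    have h2 : 1 ≤ ‖h₀ z‖ₑ := by
      rw [← ofReal_norm, ← ENNReal.ofReal_one]
      exact ENNReal.ofReal_le_ofReal hz
    refine ⟨1, one_pos, fun _ _ => rfl, z, by simpa using h1, ?_⟩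
    rw [ENNReal.coe_one, one_mul]
    exact h1.trans (le_mul_of_one_le_right' h2)
  · obtain ⟨u, hu⟩ := Function.ne_iff.mp hh₀
    set a : ℝ≥0 := ‖schwartzL2 g₀‖₊ ^ 2 with ha
    have hapos : 0 < a := pow_pos (nnnorm_pos.mpr (schwartzL2_ne_zero hg₀)) 2
    have hae : ‖schwartzL2 g₀‖ₑ ^ 2 = a := by rw [ha, ENNReal.coe_pow]; rfl
    set d : ℝ≥0 := ‖h₀ u‖₊ with hd
    have hdpos : 0 < d := nnnorm_pos.mpr hu
    have hde : ‖h₀ u‖ₑ = d := rfl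
    refine ⟨max (9 / a) (9 / (a * d)), lt_max_of_lt_left (by positivity),
      fun h1 h2 => (hcond ⟨h1, h2⟩).elim, u, ?_, ?_⟩
    · rw [hae]
      have : (9 : ℝ≥0) ≤ max (9 / a) (9 / (a * d)) * a := by
        rw [← div_le_iff₀ hapos]
        exact le_max_left _ _
      exact_mod_cast this
    · rw [hae, hde, mul_assoc]
      have : (9 : ℝ≥0) ≤ max (9 / a) (9 / (a * d)) * (a * d) := by
        rw [← div_le_iff₀ (mul_pos hapos hdpos)]
        exact le_max_right _ _
      exact_mod_cast this

end DiscreteTF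

end

/-! ### The two trace norm bounds -/

theorem mainTheorem4 (n : ℕ)
    (g₀ : DiscreteTF.schwartzZ n) (hg₀ : g₀ ≠ 0)
    (h₀ : DiscreteTF.Phase n → ℂ) (hh₀ : DiscreteTF.IsSchwartzPhase h₀) (hh₀_ne : h₀ ≠ 0) :
    ∃ C : ℝ≥0, 0 < C ∧
      (9 ≤ ∑' k, ‖(g₀ : DiscreteTF.Lattice n → ℂ) k‖ ^ 2 → (∃ z, 1 ≤ ‖h₀ z‖) → C = 1) ∧
      ∀ Φ : ℝ≥0∞ → ℝ≥0∞, DiscreteTF.IsYoungFunction Φ →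
        (∀ x : ℝ, 0 ≤ x → x ≤ Real.exp (-3 / 2) →
          Φ (ENNReal.ofReal x) = ENNReal.ofReal (-(x ^ 2 * Real.log x))) →
      ∀ s : DiscreteTF.Phase n → ℝ, (∀ᵐ z ∂(DiscreteTF.phaseMeasure n), 0 ≤ s z) →
        DiscreteTF.MemModulationOne h₀ (fun z => (s z : ℂ)) →
      ∀ g : DiscreteTF.TemperedZ n, DiscreteTF.MemOrliczModulation g₀ Φ g →
      ∃ γ : DiscreteTF.L2Z n, (∀ k, γ k = g.coeff k) ∧
      ∃ L : DiscreteTF.L2Z n →L[ℂ] DiscreteTF.L2Z n,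
        DiscreteTF.IsLocalizationOperator (fun z => (s z : ℂ)) γ γ L ∧
        DiscreteTF.IsTraceClass L ∧
        Integrable (DiscreteTF.lowerSymbol L γ) (DiscreteTF.phaseMeasure n) ∧
        (∫⁻ z, ‖DiscreteTF.lowerSymbol L γ z‖ₑ ∂(DiscreteTF.phaseMeasure n)) /
            (C * DiscreteTF.orliczModulationNorm g₀ Φ g ^ 2) ≤ DiscreteTF.schattenOneNorm L ∧
        DiscreteTF.schattenOneNorm L ≤
          C * DiscreteTF.orliczModulationNorm g₀ Φ g ^ 2 *
            DiscreteTF.modulationOneNorm h₀ (fun z => (s z : ℂ)) := by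
  obtain ⟨C, hC0, hC1, u, hCg, hCh⟩ := DiscreteTF.exists_modulation_constant g₀ hg₀ h₀ hh₀_ne
  refine ⟨C, hC0, hC1, fun Φ hΦ hlog s hs0 hs g hg => ?_⟩
  set γ : DiscreteTF.L2Z n := ⟨g.coeff, hg.memℓp hΦ hlog hg₀⟩ with hγdef
  have hγ : ∀ k, γ k = g.coeff k := fun _ => rfl
  have hN := DiscreteTF.enorm_mul_enorm_le_orliczModulationNorm hΦ hlog (g₀ := g₀) hγ
  set N := DiscreteTF.orliczModulationNorm g₀ Φ g with hNdef
  set M := DiscreteTF.modulationOneNorm h₀ (fun z => (s z : ℂ)) with hMdef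
  set I := ∫⁻ z, ‖s z‖ₑ ∂(DiscreteTF.phaseMeasure n) with hI
  have hIM : ∀ u, I * ‖h₀ u‖ₑ ≤ M := fun u => by
    have h := DiscreteTF.lintegral_enorm_mul_le_modulationOneNorm hh₀ hs u
    have e : ∀ z, ‖((s z : ℝ) : ℂ)‖ₑ = ‖s z‖ₑ := fun z => by
      rw [← ofReal_norm, Complex.norm_real, ofReal_norm]
    simpa only [e] using h
  have hN2 : ‖γ‖ₑ ^ 2 * ‖DiscreteTF.schwartzL2 g₀‖ₑ ^ 2 ≤ 9 * N ^ 2 := by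
    calc ‖γ‖ₑ ^ 2 * ‖DiscreteTF.schwartzL2 g₀‖ₑ ^ 2
        = (‖γ‖ₑ * ‖DiscreteTF.schwartzL2 g₀‖ₑ) ^ 2 := (mul_pow _ _ _).symm
      _ ≤ (3 * N) ^ 2 := pow_le_pow_left' hN 2
      _ = 9 * N ^ 2 := by rw [mul_pow]; norm_num
  have h9 : ∀ x y : ℝ≥0∞, 9 * x ≤ 9 * y → x ≤ y := fun x y h =>
    (ENNReal.mul_le_mul_iff_right (by norm_num) (by norm_num)).mp h
  have hγN : ‖γ‖ₑ ^ 2 ≤ C * N ^ 2 := by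
    refine h9 _ _ ?_
    calc 9 * ‖γ‖ₑ ^ 2 ≤ C * ‖DiscreteTF.schwartzL2 g₀‖ₑ ^ 2 * ‖γ‖ₑ ^ 2 := by gcongr
      _ = C * (‖γ‖ₑ ^ 2 * ‖DiscreteTF.schwartzL2 g₀‖ₑ ^ 2) := by ring
      _ ≤ C * (9 * N ^ 2) := by gcongr
      _ = 9 * (C * N ^ 2) := by ring
  have hγM : ‖γ‖ₑ ^ 2 * I ≤ C * N ^ 2 * M := by
    refine h9 _ _ ?_
    calc 9 * (‖γ‖ₑ ^ 2 * I)
        ≤ C * ‖DiscreteTF.schwartzL2 g₀‖ₑ ^ 2 * ‖h₀ u‖ₑ * (‖γ‖ₑ ^ 2 * I) := by gcongr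
      _ = C * (‖γ‖ₑ ^ 2 * ‖DiscreteTF.schwartzL2 g₀‖ₑ ^ 2) * (I * ‖h₀ u‖ₑ) := by ring
      _ ≤ C * (9 * N ^ 2) * M := by gcongr; exact hIM u
      _ = 9 * (C * N ^ 2 * M) := by ring
  have hIfin : I < ⊤ := by
    obtain ⟨v, hv⟩ := Function.ne_iff.mp hh₀_ne
    refine lt_top_iff_ne_top.mpr fun htop => ?_
    have h := hIM v
    rw [htop, ENNReal.top_mul (enorm_ne_zero.mpr hv), top_le_iff] at h
    exact hs.2.ne h
  have hsm : AEStronglyMeasurable s (DiscreteTF.phaseMeasure n) := by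
    simpa using Complex.continuous_re.comp_aestronglyMeasurable hs.1.1
  have hsint : Integrable s (DiscreteTF.phaseMeasure n) := ⟨hsm, hIfin⟩
  refine ⟨γ, hγ, DiscreteTF.localizationOperator s γ,
    DiscreteTF.isLocalizationOperator_localizationOperator hsint γ,
    DiscreteTF.isTraceClass_localizationOperator hsint γ hs0,
    DiscreteTF.integrable_lowerSymbol hsint γ hs0, ?_, ?_⟩
  · rw [DiscreteTF.lintegral_enorm_lowerSymbol hsint γ hs0]
    -- No case split on `g = 0` is needed: in `ℝ≥0∞` this step holds for every denominator, and `0 /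
    -- 0 = 0`.
    refine ENNReal.div_le_of_le_mul ?_
    gcongr
  · rw [DiscreteTF.schattenOneNorm_localizationOperator hsint γ hs0]
    exact hγM
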